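/- Let $n$ be a positive integer. For a bilinear form $\mathcal B$ on $\mathbb F_2^n$, call a set $S\subset\mathbb F_2^n\setminus\{\mathbf 0\}$ $(3,2)$-orthogonal with respect to $\mathcal B$ if among any three distinct vectors of $S$ there are two distinct vectors $\mathbf x,\mathbf y$ with $\mathcal B(\mathbf x,\mathbf y)=0$. For even $n$, the hyperbolic form $\mathcal H$ on $\mathbb F_2^n$ is $\mathcal H(\mathbf x,\mathbf y)=\mathbf x^{T}(H\oplus\cdots\oplus H)\mathbf y$, where the block diagonal matrix has $n/2$ blocks $H=\begin{pmatrix}0&1\\1&0\end{pmatrix}$. (i) If $S\subset\mathbb F_2^n$ is $(3,2)$-orthogonal with respect to the dot product, then $$|S|\le\begin{cases}2^{\frac{n+1}{2}}+1,&\text{if } n\ge 21 \text{ is odd};\\ 2^{\frac n2+1}-3,&\text{if } n\ge 18\text{ is even}.\end{cases}$$ (ii) If $n\ge 2$ is even and $S\subset\mathbb F_2^n$ is $(3,2)$-orthogonal with respect to the hyperbolic form $\mathcal H$, then $$|S|\le 2^{\frac n2+1}-2.$$ (iii) All these bounds are sharp: for every $n$ in the respective range there is a $(3,2)$-orthogonal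 set (with respect to the respective form) whose size equals the bound. (iv) Consequently, the largest size of a family of non-empty subsets of $\{1,\dots,n\}$ such that among every three distinct members there are two distinct ones whose intersection has even cardinality is exactly $2^{\frac{n+1}{2}}+1$ if $n\ge 21$ is odd, and exactly $2^{\frac n2+1}-3$ if $n\ge 18$ is even. -/

import Mathlib

/-- A finite set `S` of vectors is `(k, l)`-orthogonal with respect to the bilinear form `B` if it
consists of nonzero vectors and among any `k` distinct vectors of `S` there are `l` distinct ones
that are pairwise mutually orthogonal (for distinct pairs; self-orthogonality is not required). -/
def IsKLOrthogonal {F V : Type*} [Field F] [AddCommGroup V] [Module F V]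
    (B : LinearMap.BilinForm F V) (k l : ℕ) (S : Finset V) : Prop :=
  (0 : V) ∉ S ∧
    ∀ T : Finset V, T ⊆ S → T.card = k →
      ∃ U : Finset V, U ⊆ T ∧ U.card = l ∧ (U : Set V).Pairwise (fun x y => B x y = 0)

/-- The dot product on `F₂ⁿ`, i.e. the bilinear form `(x, y) ↦ xᵀ I y` of the identity matrix. -/
def dotForm (n : ℕ) : LinearMap.BilinForm (ZMod 2) (Fin n → ZMod 2) :=
  Matrix.toBilin' (1 : Matrix (Fin n) (Fin n) (ZMod 2))

/-- For even `n`, the block diagonal `n × n` matrix `H ⊕ ⋯ ⊕ H` with `n / 2` blocks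
`H = !![0, 1; 1, 0]`. With indices `0, …, n - 1`, the blocks occupy the index pairs `{2b, 2b+1}`. -/
def hyperbolicMatrix (n : ℕ) : Matrix (Fin n) (Fin n) (ZMod 2) :=
  fun i j => if (i : ℕ) / 2 = (j : ℕ) / 2 ∧ i ≠ j then 1 else 0

/-- The hyperbolic form `(x, y) ↦ xᵀ (H ⊕ ⋯ ⊕ H) y` on `F₂ⁿ`, for even `n`. -/
def hyperbolicForm (n : ℕ) : LinearMap.BilinForm (ZMod 2) (Fin n → ZMod 2) :=
  Matrix.toBilin' (hyperbolicMatrix n)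

/-- A family of nonempty subsets of an `n`-element set such that among every three distinct members
there are two (distinct ones) whose intersection has even cardinality. -/
def IsAlmostEvenFamily {n : ℕ} (A : Finset (Finset (Fin n))) : Prop :=
  (∀ X ∈ A, X.Nonempty) ∧
    ∀ X ∈ A, ∀ Y ∈ A, ∀ Z ∈ A, X ≠ Y → X ≠ Z → Y ≠ Z →
      Even (X ∩ Y).card ∨ Even (X ∩ Z).card ∨ Even (Y ∩ Z).card

/-! Over F₂ the map x ↦ B(x, x) is linear for symmetric B, so a nondegenerate B has a vector e with
B(x, x) = B(e, x); for the dot product e is the all-ones vector. A (3,2)-orthogonal set S splits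
into A, where B(x, x) = 0, and O, where B(x, x) = 1.

In a symplectic space of dimension 2m, a triangle-free set of nonzero vectors has at most 2^(m+1) -
2 elements (`IsSymplecticOn.card_triangleFree_le`). If u, v ∈ A are non-orthogonal, the vectors of A
non-orthogonal to u form an isotropic set N(u) on which B(u, ·) = 1; that is at most half of an
isotropic subspace, so |N(u)| ≤ 2^(m-1), and likewise for v. The rest of A lies in {u, v}^⊥,
symplectic of dimension 2m - 2. This settles the hyperbolic form.

The part O is small: non-orthogonality is a triangle-free graph on it whose independent sets are
orthonormal, hence of size at most n, and a Ramsey bound gives |O| ≤ n(n+3)/2.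

For n = 2m + 1 the space e^⊥ is symplectic and contains A, so |O| ≤ 3 gives 2^(m+1) + 1. If |O| ≥ 4,
the translates o + e lie in e^⊥ and force |A| ≤ (7/8)·2^(m+1) - 2
(`IsSymplecticOn.card_le_of_four`), and the gap exceeds |O| for large m.

For n = 2k + 2 we have e ∈ e^⊥, and e^⊥ is the union of a symplectic space of dimension 2k and its
translate by e. Each half contributes at most 2^(k+1) - 2, apart from e itself. A vector u ∈ O makes
one of the halves of A isotropic, which again leaves room for O.

Sharpness comes from two maximal isotropic subspaces with the smallest possible intersection, plus
three odd vectors when n is odd. -/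

section

variable {V : Type*} [AddCommGroup V] [Module (ZMod 2) V]

theorem zmod_two_eq_one_of_ne_zero {a : ZMod 2} (h : a ≠ 0) : a = 1 := by
  revert a; decide

theorem zmod_two_ne_one_iff {a : ZMod 2} : a ≠ 1 ↔ a = 0 := by
  revert a; decide

theorem zmod_two_cases (a : ZMod 2) : a = 0 ∨ a = 1 := by
  revert a; decide

theorem add_self_eq_zero_of_zmod_two (x : V) : x + x = 0 := by
  rw [← two_smul (ZMod 2) x, show (2 : ZMod 2) = 0 from rfl, zero_smul]

/-- The restriction of `B` to `W` is a symplectic (alternating, nondegenerate) form, and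
`W` has dimension `2 * m`. -/
structure IsSymplecticOn (B : LinearMap.BilinForm (ZMod 2) V) (W : Submodule (ZMod 2) V)
    (m : ℕ) : Prop where
  alt : ∀ x ∈ W, B x x = 0
  nondeg : ∀ x ∈ W, (∀ y ∈ W, B x y = 0) → x = 0
  finrank : Module.finrank (ZMod 2) W = 2 * m

/-- The vectors of `W` orthogonal to both `x` and `y`. -/
def perpPair (B : LinearMap.BilinForm (ZMod 2) V) (W : Submodule (ZMod 2) V) (x y : V) :
    Submodule (ZMod 2) V :=
  W ⊓ LinearMap.ker (B x) ⊓ LinearMap.ker (B y)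

/-- All vectors of `I` are orthogonal to each other and to themselves. -/
def IsIsotropicSet (B : LinearMap.BilinForm (ZMod 2) V) (I : Finset V) : Prop :=
  ∀ x ∈ I, ∀ y ∈ I, B x y = 0

/-- No three vectors of `A`, distinct or not, are pairwise non-orthogonal. -/
def IsTriangleFree (B : LinearMap.BilinForm (ZMod 2) V) (A : Finset V) : Prop :=
  ∀ x ∈ A, ∀ y ∈ A, ∀ z ∈ A, B x y = 0 ∨ B x z = 0 ∨ B y z = 0

/-- The vectors of `A` that are not orthogonal to `u`. -/
def nonOrth (B : LinearMap.BilinForm (ZMod 2) V) (A : Finset V) (u : V) : Finset V :=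
  A.filter (fun a => B u a = 1)

/-! ### Isotropic and triangle-free sets in a symplectic space -/

section
variable {B : LinearMap.BilinForm (ZMod 2) V} {W : Submodule (ZMod 2) V} {m : ℕ}

theorem mem_perpPair {x y a : V} : a ∈ perpPair B W x y ↔ a ∈ W ∧ B x a = 0 ∧ B y a = 0 := by
  simp [perpPair, and_assoc]

theorem mem_nonOrth {A : Finset V} {u a : V} : a ∈ nonOrth B A u ↔ a ∈ A ∧ B u a = 1 := by
  simp [nonOrth]

theorem IsIsotropicSet.mono {I J : Finset V} (h : IsIsotropicSet B J) (hIJ : I ⊆ J) :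
    IsIsotropicSet B I := fun x hx y hy => h x (hIJ hx) y (hIJ hy)

theorem IsTriangleFree.mono {I J : Finset V} (h : IsTriangleFree B J) (hIJ : I ⊆ J) :
    IsTriangleFree B I := fun x hx y hy z hz => h x (hIJ hx) y (hIJ hy) z (hIJ hz)

theorem IsTriangleFree.isIsotropicSet_nonOrth {A : Finset V} (h : IsTriangleFree B A) {u : V}
    (hu : u ∈ A) : IsIsotropicSet B (nonOrth B A u) := by
  intro x hx y hy
  rw [mem_nonOrth] at hx hy
  rcases h u hu x hx.1 y hy.1 with h | h | h
  · simp [hx.2] at h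
  · simp [hy.2] at h
  · exact h

theorem card_le_add_nonOrth_union [DecidableEq V] {k c : ℕ}
    {A : Finset V} (hAW : ∀ a ∈ A, a ∈ W) {u v : V}
    (hc : ∀ A' ⊆ A, (∀ a ∈ A', a ∈ perpPair B W u v) → A'.card + k ≤ c) :
    A.card + k ≤ c + (nonOrth B A u ∪ nonOrth B A v).card := by
  have h1 := hc (A \ (nonOrth B A u ∪ nonOrth B A v)) Finset.sdiff_subset (by
    intro a ha
    simp only [Finset.mem_sdiff, Finset.mem_union, mem_nonOrth, not_or, not_and] at ha
    exact mem_perpPair.2 ⟨hAW a ha.1, zmod_two_ne_one_iff.1 (ha.2.1 ha.1),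
      zmod_two_ne_one_iff.1 (ha.2.2 ha.1)⟩)
  have h2 := Finset.le_card_sdiff (nonOrth B A u ∪ nonOrth B A v) A
  omega

variable [FiniteDimensional (ZMod 2) V]

theorem finrank_perpPair_add_two {x y p q : V} (hp : p ∈ W) (hq : q ∈ W) (hxp : B x p = 1)
    (hyp : B y p = 0) (hxq : B x q = 0) (hyq : B y q = 1) :
    Module.finrank (ZMod 2) (perpPair B W x y) + 2 = Module.finrank (ZMod 2) W := by
  let f : W →ₗ[ZMod 2] ZMod 2 × ZMod 2 := ((B x).prod (B y)).domRestrict W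
  have hf : ∀ w : W, f w = (B x w, B y w) := fun w => rfl
  have hsurj : LinearMap.range f = ⊤ := by
    rw [LinearMap.range_eq_top]
    rintro ⟨a, b⟩
    refine ⟨a • ⟨p, hp⟩ + b • ⟨q, hq⟩, ?_⟩
    rw [hf]
    simp [hxp, hyp, hxq, hyq]
  have hker : (LinearMap.ker f).map W.subtype = perpPair B W x y := by
    ext w
    rw [mem_perpPair]
    simp [hf]
    tauto
  have h1 := LinearMap.finrank_range_add_finrank_ker f
  rw [hsurj, finrank_top, Module.finrank_prod, Module.finrank_self,
    ← Submodule.finrank_map_subtype_eq W (LinearMap.ker f), hker] at h1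
  omega

/-- Splitting off the hyperbolic plane spanned by x and y; this drives every induction on m. -/
theorem IsSymplecticOn.exists_perpPair (hB : ∀ x y, B x y = B y x) (hW : IsSymplecticOn B W m)
    {x y : V} (hx : x ∈ W) (hy : y ∈ W) (hxy : B x y = 1) :
    ∃ k, m = k + 1 ∧ IsSymplecticOn B (perpPair B W x y) k := by
  have hyx : B y x = 1 := by rw [hB, hxy]
  have h1 := finrank_perpPair_add_two hy hx hxy (hW.alt y hy) (hW.alt x hx) hyx
  rw [hW.finrank] at h1
  refine ⟨m - 1, by omega, fun w hw => hW.alt w (mem_perpPair.1 hw).1, ?_, by omega⟩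
  intro w hw h0
  obtain ⟨hwW, hw1, hw2⟩ := mem_perpPair.1 hw
  refine hW.nondeg w hwW fun z hz => ?_
  -- The projection of z onto the complement of the plane spanned by x and y.
  have hz' : z + B y z • x + B x z • y ∈ perpPair B W x y := by
    rw [mem_perpPair]
    refine ⟨W.add_mem (W.add_mem hz (W.smul_mem _ hx)) (W.smul_mem _ hy), ?_, ?_⟩
    · simp [hxy, hW.alt x hx, CharTwo.add_self_eq_zero]
    · simp [hyx, hW.alt y hy, CharTwo.add_self_eq_zero]
  have := h0 _ hz'
  simpa [hB w x, hB w y, hw1, hw2] using this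

theorem IsSymplecticOn.finrank_isotropic_le (hB : ∀ x y, B x y = B y x) :
    ∀ {m : ℕ} {W : Submodule (ZMod 2) V}, IsSymplecticOn B W m → ∀ M : Submodule (ZMod 2) V,
      M ≤ W → (∀ x ∈ M, ∀ y ∈ M, B x y = 0) → Module.finrank (ZMod 2) M ≤ m := by
  intro m
  induction m with
  | zero =>
    intro W hW M hM _
    have := Submodule.finrank_mono hM
    rwa [hW.finrank] at this
  | succ m ih =>
    intro W hW M hM hiso
    by_cases hbot : M = ⊥
    · subst hbot; simp
    obtain ⟨x, hxM, hx0⟩ := M.ne_bot_iff.1 hbot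
    obtain ⟨z, hz, hxz⟩ : ∃ z ∈ W, B x z ≠ 0 := by
      by_contra! h
      exact hx0 (hW.nondeg x (hM hxM) h)
    obtain ⟨k, hk, hW'⟩ := hW.exists_perpPair hB (hM hxM) hz (zmod_two_eq_one_of_ne_zero hxz)
    obtain rfl : m = k := by omega
    -- The part of M orthogonal to z lies in {x, z}^⊥, one level lower, and M loses at most one
    -- dimension to it.
    have h1 := ih hW' (M ⊓ LinearMap.ker (B z))
      (fun w hw => mem_perpPair.2 ⟨hM hw.1, hiso x hxM w hw.1, hw.2⟩)
      (fun a ha b hb => hiso a ha.1 b hb.1)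
    let f : M →ₗ[ZMod 2] ZMod 2 := (B z).domRestrict M
    have hker : (LinearMap.ker f).map M.subtype = M ⊓ LinearMap.ker (B z) := by
      ext w; simp [f, and_comm]
    have h2 := LinearMap.finrank_range_add_finrank_ker f
    rw [← Submodule.finrank_map_subtype_eq M (LinearMap.ker f), hker] at h2
    have h3 := Submodule.finrank_le (LinearMap.range f)
    rw [Module.finrank_self] at h3
    omega

theorem IsSymplecticOn.card_isotropic_le (hB : ∀ x y, B x y = B y x) (hW : IsSymplecticOn B W m)
    {I : Finset V} (hIW : ∀ a ∈ I, a ∈ W) (hI : IsIsotropicSet B I) : I.card ≤ 2 ^ m := by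
  have h := hW.finrank_isotropic_le hB (Submodule.span (ZMod 2) (I : Set V))
    (Submodule.span_le.2 hIW) (by
      intro x hx y hy
      induction hx, hy using Submodule.span_induction₂ with
      | mem_mem x y hx hy => exact hI x hx y hy
      | zero_left => simp
      | zero_right => simp
      | add_left x y z _ _ _ h1 h2 => simp [h1, h2]
      | add_right x y z _ _ _ h1 h2 => simp [h1, h2]
      | smul_left r x y _ _ h => simp [h]
      | smul_right r x y _ _ h => simp [h])
  have : Finite V := Module.finite_of_finite (ZMod 2)
  have h1 : I.card ≤ Nat.card (Submodule.span (ZMod 2) (I : Set V)) := by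
    rw [← Set.ncard_coe_finset]
    exact Set.ncard_le_ncard Submodule.subset_span (Set.toFinite _)
  rw [Module.natCard_eq_pow_finrank (K := ZMod 2), Nat.card_zmod] at h1
  exact h1.trans (Nat.pow_le_pow_right (by norm_num) h)

theorem IsSymplecticOn.card_isotropic_lt (hB : ∀ x y, B x y = B y x) (hW : IsSymplecticOn B W m)
    {I : Finset V} (hIW : ∀ a ∈ I, a ∈ W) (hI : IsIsotropicSet B I) (h0 : (0 : V) ∉ I) :
    I.card + 1 ≤ 2 ^ m := by
  classical
  rw [← Finset.card_insert_of_notMem h0]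
  refine hW.card_isotropic_le hB (by simpa [W.zero_mem] using hIW) ?_
  intro x hx y hy
  rw [Finset.mem_insert] at hx hy
  rcases hx with rfl | hx
  · simp
  rcases hy with rfl | hy
  · simp
  exact hI x hx y hy

/-- For i ∈ I the translate I + i is disjoint from I, because B(u, ·) vanishes on it, and the union
of the two is still isotropic. -/
theorem IsSymplecticOn.two_mul_card_isotropic_le (hB : ∀ x y, B x y = B y x)
    (hW : IsSymplecticOn B W m) {I : Finset V} (hIW : ∀ a ∈ I, a ∈ W) (hI : IsIsotropicSet B I)
    (u : V) (hu : ∀ a ∈ I, B u a = 1) : 2 * I.card ≤ 2 ^ m := by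
  classical
  rcases I.eq_empty_or_nonempty with rfl | ⟨i, hi⟩
  · simp
  have hinj : Function.Injective fun a : V => a + i := add_left_injective i
  have hdisj : Disjoint I (I.image fun a => a + i) := by
    rw [Finset.disjoint_left]
    intro a ha ha'
    obtain ⟨b, hb, rfl⟩ := Finset.mem_image.1 ha'
    have := hu _ ha
    simp [hu b hb, hu i hi, CharTwo.add_self_eq_zero] at this
  have hcard : (I ∪ I.image fun a => a + i).card = 2 * I.card := by
    rw [Finset.card_union_of_disjoint hdisj, Finset.card_image_of_injective _ hinj, two_mul]
  rw [← hcard]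
  refine hW.card_isotropic_le hB ?_ ?_
  · intro a ha
    rcases Finset.mem_union.1 ha with ha | ha
    · exact hIW a ha
    · obtain ⟨b, hb, rfl⟩ := Finset.mem_image.1 ha
      exact W.add_mem (hIW b hb) (hIW i hi)
  · intro x hx y hy
    simp only [Finset.mem_union, Finset.mem_image] at hx hy
    rcases hx with hx | ⟨x, hx, rfl⟩ <;> rcases hy with hy | ⟨y, hy, rfl⟩ <;>
      simp [hI _ hx _ hy, hI _ hx _ hi, hI _ hi _ hy, hI _ hi _ hi]

theorem IsSymplecticOn.two_mul_card_nonOrth_le (hB : ∀ x y, B x y = B y x)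
    (hW : IsSymplecticOn B W m) {A : Finset V} (hAW : ∀ a ∈ A, a ∈ W) {u : V}
    (hu : IsIsotropicSet B (nonOrth B A u)) : 2 * (nonOrth B A u).card ≤ 2 ^ m :=
  hW.two_mul_card_isotropic_le hB (fun a ha => hAW a (mem_nonOrth.1 ha).1) hu u
    (fun _ ha => (mem_nonOrth.1 ha).2)

theorem IsSymplecticOn.card_triangleFree_le (hB : ∀ x y, B x y = B y x) :
    ∀ {m : ℕ} {W : Submodule (ZMod 2) V}, IsSymplecticOn B W m → ∀ {A : Finset V},
      (∀ a ∈ A, a ∈ W) → (0 : V) ∉ A → IsTriangleFree B A → A.card + 2 ≤ 2 ^ (m + 1) := by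
  classical
  intro m
  induction m with
  | zero =>
    intro W hW A hAW h0 _
    have hA : A = ∅ := by
      rw [Finset.eq_empty_iff_forall_notMem]
      intro a ha
      have h := hAW a ha
      have hbot : W = ⊥ := Submodule.finrank_eq_zero.1 hW.finrank
      rw [hbot, Submodule.mem_bot] at h
      exact h0 (h ▸ ha)
    simp [hA]
  | succ m ih =>
    intro W hW A hAW h0 hA
    by_cases hI : IsIsotropicSet B A
    · have := hW.card_isotropic_lt hB hAW hI h0
      have h2 : 1 ≤ 2 ^ (m + 1) := Nat.one_le_two_pow
      rw [pow_succ 2 (m + 1)]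
      omega
    · simp only [IsIsotropicSet, not_forall] at hI
      obtain ⟨u, hu, v, hv, huv⟩ := hI
      obtain ⟨k, hk, hW'⟩ := hW.exists_perpPair hB (hAW u hu) (hAW v hv)
        (zmod_two_eq_one_of_ne_zero huv)
      obtain rfl : m = k := by omega
      have h1 := card_le_add_nonOrth_union (B := B) (k := 2) (u := u) (v := v) hAW fun A' hA' h =>
        ih hW' h (fun h => h0 (hA' h)) (hA.mono hA')
      have h2 := hW.two_mul_card_nonOrth_le hB hAW (hA.isIsotropicSet_nonOrth hu)
      have h3 := hW.two_mul_card_nonOrth_le hB hAW (hA.isIsotropicSet_nonOrth hv)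
      have h4 := Finset.card_union_le (nonOrth B A u) (nonOrth B A v)
      rw [pow_succ 2 (m + 1)]
      omega

/-- The counting step of the preceding induction, for u and v that need not belong to A. -/
theorem IsSymplecticOn.card_triangleFree_le_union [DecidableEq V] (hB : ∀ x y, B x y = B y x)
    (hW : IsSymplecticOn B W m) {A : Finset V} (hAW : ∀ a ∈ A, a ∈ W) (h0 : (0 : V) ∉ A)
    (hA : IsTriangleFree B A) {u v : V} (hu : u ∈ W) (hv : v ∈ W) (huv : B u v = 1) :
    A.card + 2 ≤ 2 ^ m + (nonOrth B A u ∪ nonOrth B A v).card := by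
  obtain ⟨k, rfl, hW'⟩ := hW.exists_perpPair hB hu hv huv
  exact card_le_add_nonOrth_union hAW fun A' hA' h =>
    hW'.card_triangleFree_le hB h (fun h => h0 (hA' h)) (hA.mono hA')

end

end

/-! ### Three pairwise non-orthogonal vectors with isotropic neighbourhoods -/

section

theorem card_filter_add_card_filter {α : Type*} (A : Finset α) (p : α → Prop) [DecidablePred p]
    (f : α → ZMod 2) :
    (A.filter p).card =
      (A.filter fun a => p a ∧ f a = 0).card + (A.filter fun a => p a ∧ f a = 1).card := by
  classical
  rw [← Finset.card_union_of_disjoint]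
  · congr 1
    ext a
    have := zmod_two_cases (f a)
    simp only [Finset.mem_union, Finset.mem_filter]
    tauto
  · rw [Finset.disjoint_left]
    intro a ha hb
    have h1 := (Finset.mem_filter.1 ha).2.2
    have h2 := (Finset.mem_filter.1 hb).2.2
    rw [h1] at h2
    exact absurd h2 (by decide)

variable {V : Type*} [AddCommGroup V] [Module (ZMod 2) V]

section
variable {B : LinearMap.BilinForm (ZMod 2) V} {W : Submodule (ZMod 2) V} {m k : ℕ}

/-- The number of vectors of `A` whose products with `u`, `v`, `w` are `i`, `j`, `l`. -/
def typeCard (B : LinearMap.BilinForm (ZMod 2) V) (A : Finset V) (u v w : V) (i j l : ZMod 2) :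
    ℕ :=
  (A.filter fun a => B u a = i ∧ B v a = j ∧ B w a = l).card

theorem typeCard_rotate (A : Finset V) (u v w : V) (i j l : ZMod 2) :
    typeCard B A w u v l i j = typeCard B A u v w i j l := by
  unfold typeCard
  congr 1
  exact Finset.filter_congr fun a _ => by tauto

theorem exists_of_typeCard_ne_zero {A : Finset V} {u v w : V} {i j l : ZMod 2}
    (h : typeCard B A u v w i j l ≠ 0) : ∃ a ∈ A, B u a = i ∧ B v a = j ∧ B w a = l := by
  obtain ⟨a, ha⟩ := Finset.card_ne_zero.1 h
  exact ⟨a, Finset.mem_filter.1 ha⟩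

theorem card_filter_eq_typeCard (A : Finset V) (u v w : V) (i j : ZMod 2) :
    (A.filter fun a => B u a = i ∧ B v a = j).card =
      typeCard B A u v w i j 0 + typeCard B A u v w i j 1 := by
  rw [card_filter_add_card_filter A _ (B w)]
  simp only [typeCard, and_assoc]

theorem card_nonOrth_eq_typeCard (A : Finset V) (u v w : V) :
    (nonOrth B A u).card = typeCard B A u v w 1 0 0 + typeCard B A u v w 1 0 1 +
      typeCard B A u v w 1 1 0 + typeCard B A u v w 1 1 1 := by
  rw [nonOrth, card_filter_add_card_filter A _ (B v), card_filter_eq_typeCard A u v w,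
    card_filter_eq_typeCard A u v w]
  ring

theorem card_nonOrth_union_eq_typeCard [DecidableEq V] (A : Finset V) (u v w : V) :
    (nonOrth B A u ∪ nonOrth B A v).card = typeCard B A u v w 1 0 0 + typeCard B A u v w 1 0 1 +
      typeCard B A u v w 1 1 0 + typeCard B A u v w 1 1 1 + typeCard B A u v w 0 1 0 +
      typeCard B A u v w 0 1 1 := by
  have h : nonOrth B A u ∪ nonOrth B A v =
      nonOrth B A u ∪ A.filter fun a => B u a = 0 ∧ B v a = 1 := by
    ext a
    have := zmod_two_cases (B u a)
    simp only [Finset.mem_union, mem_nonOrth, Finset.mem_filter]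
    tauto
  rw [h, Finset.card_union_of_disjoint, card_nonOrth_eq_typeCard A u v w,
    card_filter_eq_typeCard A u v w]
  · ring
  · rw [Finset.disjoint_left]
    intro a ha hb
    have h1 := (mem_nonOrth.1 ha).2
    have h2 := (Finset.mem_filter.1 hb).2.1
    rw [h1] at h2
    exact absurd h2 (by decide)

theorem card_eq_typeCard [DecidableEq V] (A : Finset V) (u v w : V) :
    A.card = typeCard B A u v w 0 0 0 + typeCard B A u v w 0 0 1 +
      (nonOrth B A u ∪ nonOrth B A v).card := by
  rw [card_nonOrth_union_eq_typeCard A u v w]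
  have h := card_filter_add_card_filter A (fun _ => True) (B u)
  simp only [Finset.filter_true, true_and] at h
  rw [h, card_filter_add_card_filter A (fun a => B u a = 0) (B v),
    card_filter_add_card_filter A (fun a => B u a = 1) (B v),
    card_filter_eq_typeCard A u v w, card_filter_eq_typeCard A u v w,
    card_filter_eq_typeCard A u v w, card_filter_eq_typeCard A u v w]
  ring

variable [FiniteDimensional (ZMod 2) V]

/-- The images of a + e and a + f under (B v, B w) are independent, so translating one fibre by
their span gives four disjoint copies. Their union is isotropic and still satisfies B(u, ·) = 1,
which costs another factor 2. -/
theorem IsSymplecticOn.eight_mul_card_isotropic_le (hB : ∀ x y, B x y = B y x)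
    (hW : IsSymplecticOn B W m) {I : Finset V} (hIW : ∀ a ∈ I, a ∈ W) (hI : IsIsotropicSet B I)
    {u : V} (hu : ∀ a ∈ I, B u a = 1) {v w a e f : V} (ha : a ∈ I) (he : e ∈ I) (hf : f ∈ I)
    (hdet : B v (a + e) * B w (a + f) + B v (a + f) * B w (a + e) = 1)
    (j l : ZMod 2) : 8 * (I.filter fun a => B v a = j ∧ B w a = l).card ≤ 2 ^ m := by
  classical
  set T := I.filter fun a => B v a = j ∧ B w a = l with hT
  let g : V × ZMod 2 × ZMod 2 → V := fun x => x.1 + x.2.1 • (a + e) + x.2.2 • (a + f)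
  have hTI : ∀ x ∈ T, x ∈ I := fun x hx => (Finset.mem_filter.1 hx).1
  have hTv : ∀ x ∈ T, B v x = j ∧ B w x = l := fun x hx => (Finset.mem_filter.1 hx).2
  have hinj : Set.InjOn g (T ×ˢ (Finset.univ : Finset (ZMod 2 × ZMod 2)) : Finset _) := by
    rintro ⟨x, s, r⟩ hx ⟨x', s', r'⟩ hx' h
    simp only [Finset.coe_product, Set.mem_prod, Finset.mem_coe, Finset.mem_univ] at hx hx'
    -- Cramer's rule: s and r are recovered from the values under B v and B w.
    have key : ∀ p q p' q' s r s' r' j l : ZMod 2, p * q' + p' * q = 1 →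
        j + s * p + r * p' = j + s' * p + r' * p' → l + s * q + r * q' = l + s' * q + r' * q' →
        s = s' ∧ r = r' := by decide
    have h1 := congrArg (B v) h
    have h2 := congrArg (B w) h
    simp only [g, map_add (B v) (_ + _), map_add (B w) (_ + _), map_add (B v) x, map_add (B v) x',
      map_add (B w) x, map_add (B w) x', map_smul, smul_eq_mul, hTv x hx.1, hTv x' hx'.1] at h1 h2
    obtain ⟨rfl, rfl⟩ := key _ _ _ _ _ _ _ _ _ _ hdet h1 h2
    simp only [g, add_left_inj] at h
    rw [h]
  have hcard : ((T ×ˢ (Finset.univ : Finset (ZMod 2 × ZMod 2))).image g).card = 4 * T.card := by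
    rw [Finset.card_image_of_injOn hinj, Finset.card_product, Finset.card_univ,
      Fintype.card_prod, ZMod.card, mul_comm]
  have := hW.two_mul_card_isotropic_le hB
    (I := (T ×ˢ (Finset.univ : Finset (ZMod 2 × ZMod 2))).image g) ?_ ?_ u ?_
  · rw [hcard] at this
    omega
  · rintro y hy
    obtain ⟨⟨x, s, r⟩, hx, rfl⟩ := Finset.mem_image.1 hy
    rw [Finset.mem_product] at hx
    exact W.add_mem (W.add_mem (hIW _ (hTI _ hx.1)) (W.smul_mem _ (W.add_mem (hIW _ ha) (hIW _ he))))
      (W.smul_mem _ (W.add_mem (hIW _ ha) (hIW _ hf)))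
  · intro y hy y' hy'
    obtain ⟨⟨x, s, r⟩, hx, rfl⟩ := Finset.mem_image.1 hy
    obtain ⟨⟨x', s', r'⟩, hx', rfl⟩ := Finset.mem_image.1 hy'
    rw [Finset.mem_product] at hx hx'
    have hx := hTI _ hx.1
    have hx' := hTI _ hx'.1
    simp [g, hI _ hx _ hx', hI _ hx _ ha, hI _ hx _ he, hI _ hx _ hf, hI _ ha _ hx',
      hI _ he _ hx', hI _ hf _ hx', hI _ ha _ ha, hI _ ha _ he, hI _ ha _ hf, hI _ he _ ha,
      hI _ he _ he, hI _ he _ hf, hI _ hf _ ha, hI _ hf _ he, hI _ hf _ hf]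
  · intro y hy
    obtain ⟨⟨x, s, r⟩, hx, rfl⟩ := Finset.mem_image.1 hy
    rw [Finset.mem_product] at hx
    simp [g, hu _ (hTI _ hx.1), hu _ ha, hu _ he, hu _ hf, CharTwo.add_self_eq_zero]

/-- Three distinct points of F₂² are affinely independent. So either at most one type besides
(1,0,0) occurs in N(u), or the preceding bound applies to all four fibres of N(u). -/
theorem IsSymplecticOn.typeCard_dichotomy (hB : ∀ x y, B x y = B y x)
    (hW : IsSymplecticOn B W (k + 2)) {A : Finset V} (hAW : ∀ a ∈ A, a ∈ W) {u v w : V}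
    (hu : IsIsotropicSet B (nonOrth B A u)) (h100 : typeCard B A u v w 1 0 0 ≠ 0) :
    (typeCard B A u v w 1 1 0 = 0 ∧ typeCard B A u v w 1 0 1 = 0) ∨
    (typeCard B A u v w 1 1 0 = 0 ∧ typeCard B A u v w 1 1 1 = 0) ∨
    (typeCard B A u v w 1 0 1 = 0 ∧ typeCard B A u v w 1 1 1 = 0) ∨
    (2 * typeCard B A u v w 1 0 0 ≤ 2 ^ k ∧ 2 * typeCard B A u v w 1 1 0 ≤ 2 ^ k ∧
      2 * typeCard B A u v w 1 0 1 ≤ 2 ^ k ∧ 2 * typeCard B A u v w 1 1 1 ≤ 2 ^ k) := by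
  have hN : ∀ j l, typeCard B A u v w 1 j l =
      ((nonOrth B A u).filter fun a => B v a = j ∧ B w a = l).card := by
    intro j l
    rw [nonOrth, Finset.filter_filter, typeCard]
  obtain ⟨a, haA, hau, hav, haw⟩ := exists_of_typeCard_ne_zero h100
  have main : ∀ e ∈ A, ∀ f ∈ A, B u e = 1 → B u f = 1 →
      B v (a + e) * B w (a + f) + B v (a + f) * B w (a + e) = 1 →
      (2 * typeCard B A u v w 1 0 0 ≤ 2 ^ k ∧ 2 * typeCard B A u v w 1 1 0 ≤ 2 ^ k ∧
      2 * typeCard B A u v w 1 0 1 ≤ 2 ^ k ∧ 2 * typeCard B A u v w 1 1 1 ≤ 2 ^ k) := by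
    intro e he f hf hue huf hdet
    have h := hW.eight_mul_card_isotropic_le hB (fun a ha => hAW a (mem_nonOrth.1 ha).1) hu
      (fun _ ha => (mem_nonOrth.1 ha).2) (mem_nonOrth.2 ⟨haA, hau⟩) (mem_nonOrth.2 ⟨he, hue⟩)
      (mem_nonOrth.2 ⟨hf, huf⟩) hdet
    simp only [← hN, pow_add] at h
    have h00 := h 0 0
    have h10 := h 1 0
    have h01 := h 0 1
    have h11 := h 1 1
    omega
  by_cases h1 : typeCard B A u v w 1 1 0 = 0
  · by_cases h2 : typeCard B A u v w 1 0 1 = 0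
    · exact Or.inl ⟨h1, h2⟩
    by_cases h3 : typeCard B A u v w 1 1 1 = 0
    · exact Or.inr (Or.inl ⟨h1, h3⟩)
    obtain ⟨e, he, he1, he2, he3⟩ := exists_of_typeCard_ne_zero h2
    obtain ⟨f, hf, hf1, hf2, hf3⟩ := exists_of_typeCard_ne_zero h3
    refine Or.inr (Or.inr (Or.inr (main e he f hf he1 hf1 ?_)))
    rw [map_add, map_add, map_add, map_add, hav, haw, he2, he3, hf2, hf3]
    decide
  obtain ⟨e, he, he1, he2, he3⟩ := exists_of_typeCard_ne_zero h1
  by_cases h2 : typeCard B A u v w 1 0 1 = 0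
  · by_cases h3 : typeCard B A u v w 1 1 1 = 0
    · exact Or.inr (Or.inr (Or.inl ⟨h2, h3⟩))
    obtain ⟨f, hf, hf1, hf2, hf3⟩ := exists_of_typeCard_ne_zero h3
    refine Or.inr (Or.inr (Or.inr (main e he f hf he1 hf1 ?_)))
    rw [map_add, map_add, map_add, map_add, hav, haw, he2, he3, hf2, hf3]
    decide
  obtain ⟨f, hf, hf1, hf2, hf3⟩ := exists_of_typeCard_ne_zero h2
  refine Or.inr (Or.inr (Or.inr (main e he f hf he1 hf1 ?_)))
  rw [map_add, map_add, map_add, map_add, hav, haw, he2, he3, hf2, hf3]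
  decide

theorem IsSymplecticOn.typeCard_one_zero_zero_le (hB : ∀ x y, B x y = B y x)
    (hW : IsSymplecticOn B W (k + 2)) {A : Finset V} (hAW : ∀ a ∈ A, a ∈ W) {u v w : V}
    (hv : v ∈ W) (hw : w ∈ W) (hvw : B v w = 1)
    (hu : IsIsotropicSet B (nonOrth B A u)) : typeCard B A u v w 1 0 0 ≤ 2 ^ k := by
  obtain ⟨k', hk, hW'⟩ := hW.exists_perpPair hB hv hw hvw
  obtain rfl : k' = k + 1 := by omega
  have := hW'.two_mul_card_isotropic_le hB
    (I := A.filter fun a => B u a = 1 ∧ B v a = 0 ∧ B w a = 0)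
    (fun a ha => by
      rw [Finset.mem_filter] at ha
      exact mem_perpPair.2 ⟨hAW a ha.1, ha.2.2⟩)
    (hu.mono fun a ha => by
      rw [Finset.mem_filter] at ha
      exact mem_nonOrth.2 ⟨ha.1, ha.2.1⟩) u
    (fun a ha => (Finset.mem_filter.1 ha).2.1)
  rw [typeCard]
  rw [pow_succ] at this
  omega

/-- Take a of type (1,0,0). In {u, v}^⊥ the vectors u + v + w and a + v are non-orthogonal. No
vector of type (0,0,0) meets the first non-trivially, and those non-orthogonal to the second are
neighbours of a, hence isotropic: the count is 2^(k+1) + 2^k. -/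
theorem IsSymplecticOn.typeCard_zero_le (hB : ∀ x y, B x y = B y x)
    (hW : IsSymplecticOn B W (k + 2)) {A : Finset V} (hAW : ∀ a ∈ A, a ∈ W) (h0 : (0 : V) ∉ A)
    (hA : IsTriangleFree B A) {u v w : V} (hu : u ∈ W) (hv : v ∈ W) (hw : w ∈ W)
    (huv : B u v = 1) (huw : B u w = 1) (hvw : B v w = 1)
    (h100 : typeCard B A u v w 1 0 0 ≠ 0) :
    typeCard B A u v w 0 0 0 + 2 ≤ 3 * 2 ^ k := by
  classical
  obtain ⟨k', hk, hW'⟩ := hW.exists_perpPair hB hu hv huv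
  obtain rfl : k' = k + 1 := by omega
  obtain ⟨a, haA, hau, hav, haw⟩ := exists_of_typeCard_ne_zero h100
  have hvu : B v u = 1 := by rw [hB, huv]
  have hua : B u (a + v) = 0 := by simp [hau, huv, CharTwo.add_self_eq_zero]
  have hva : B v (a + v) = 0 := by simp [hav, hW.alt v hv]
  set A' := A.filter fun a => B u a = 0 ∧ B v a = 0 ∧ B w a = 0 with hA'
  have hsub : ∀ x ∈ A', x ∈ A ∧ B u x = 0 ∧ B v x = 0 ∧ B w x = 0 := fun x hx =>
    Finset.mem_filter.1 hx
  have hAW' : ∀ x ∈ A', x ∈ perpPair B W u v := fun x hx =>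
    mem_perpPair.2 ⟨hAW x (hsub x hx).1, (hsub x hx).2.1, (hsub x hx).2.2.1⟩
  have h1 := hW'.card_triangleFree_le_union hB hAW' (fun h => h0 (hsub 0 h).1)
    (hA.mono (Finset.filter_subset _ _)) (u := u + v + w) (v := a + v)
    (mem_perpPair.2 ⟨W.add_mem (W.add_mem hu hv) hw,
      by simp [huv, huw, hW.alt u hu, CharTwo.add_self_eq_zero],
      by simp [hvu, hvw, hW.alt v hv, CharTwo.add_self_eq_zero]⟩)
    (mem_perpPair.2 ⟨W.add_mem (hAW a haA) hv, hua, hva⟩)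
    (by rw [map_add B, map_add B, LinearMap.add_apply, LinearMap.add_apply, hua, hva, map_add, haw,
      hB w v, hvw, zero_add, zero_add, zero_add])
  have h2 : nonOrth B A' (u + v + w) = ∅ := by
    rw [Finset.eq_empty_iff_forall_notMem]
    intro x hx
    obtain ⟨hx, hx1⟩ := mem_nonOrth.1 hx
    obtain ⟨_, h1, h2, h3⟩ := hsub x hx
    simp [h1, h2, h3] at hx1
  have h3 : IsIsotropicSet B (nonOrth B A' (a + v)) := by
    refine (hA.isIsotropicSet_nonOrth haA).mono fun x hx => ?_
    obtain ⟨hx, hx1⟩ := mem_nonOrth.1 hx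
    obtain ⟨hx2, _, h2, _⟩ := hsub x hx
    refine mem_nonOrth.2 ⟨hx2, ?_⟩
    simpa [h2] using hx1
  have h4 := hW'.two_mul_card_nonOrth_le hB hAW' h3
  rw [h2, Finset.empty_union] at h1
  rw [typeCard, ← hA']
  rw [pow_succ] at h1 h4
  omega

/-- If the bound fails, each two of N(u), N(v), N(w) have a union larger than 3·2^k, although each
set has at most 2·2^k elements. The types (1,0,0), (0,1,0), (0,0,1) then all occur, the dichotomy
applies at u, v and w, and the bounds on these types and on (0,0,0) exclude every combination by
linear arithmetic. -/
theorem IsSymplecticOn.card_le_of_nonOrth_triple (hB : ∀ x y, B x y = B y x)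
    (hW : IsSymplecticOn B W (k + 2)) {A : Finset V} (hAW : ∀ a ∈ A, a ∈ W) (h0 : (0 : V) ∉ A)
    (hA : IsTriangleFree B A) {u v w : V} (hu : u ∈ W) (hv : v ∈ W) (hw : w ∈ W)
    (huv : B u v = 1) (huw : B u w = 1) (hvw : B v w = 1)
    (hNu : IsIsotropicSet B (nonOrth B A u)) (hNv : IsIsotropicSet B (nonOrth B A v))
    (hNw : IsIsotropicSet B (nonOrth B A w)) : A.card + 2 ≤ 7 * 2 ^ k := by
  classical
  by_contra hcon
  have huv' := hW.card_triangleFree_le_union hB hAW h0 hA hu hv huv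
  have hwu' := hW.card_triangleFree_le_union hB hAW h0 hA hw hu (by rw [hB, huw])
  have hvw' := hW.card_triangleFree_le_union hB hAW h0 hA hv hw hvw
  have hcard := card_eq_typeCard (B := B) A u v w
  rw [card_nonOrth_union_eq_typeCard A u v w] at huv' hcard
  rw [card_nonOrth_union_eq_typeCard A w u v] at hwu'
  rw [card_nonOrth_union_eq_typeCard A v w u] at hvw'
  have hnu := hW.two_mul_card_nonOrth_le hB hAW hNu
  have hnv := hW.two_mul_card_nonOrth_le hB hAW hNv
  have hnw := hW.two_mul_card_nonOrth_le hB hAW hNw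
  rw [card_nonOrth_eq_typeCard A u v w] at hnu
  rw [card_nonOrth_eq_typeCard A v w u] at hnv
  rw [card_nonOrth_eq_typeCard A w u v] at hnw
  have hqu := hW.typeCard_one_zero_zero_le hB hAW hv hw hvw hNu
  have hqv := hW.typeCard_one_zero_zero_le hB hAW hw hu (by rw [hB, huw]) hNv
  have hqw := hW.typeCard_one_zero_zero_le hB hAW hu hv huv hNw
  have hdu := hW.typeCard_dichotomy hB hAW (v := v) (w := w) hNu
  have hdv := hW.typeCard_dichotomy hB hAW (v := w) (w := u) hNv
  have hdw := hW.typeCard_dichotomy hB hAW (v := u) (w := v) hNw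
  have hz := hW.typeCard_zero_le hB hAW h0 hA hu hv hw huv huw hvw
  have hrot : ∀ i j l, typeCard B A v w u j l i = typeCard B A u v w i j l := fun i j l =>
    (typeCard_rotate A v w u j l i).symm
  simp only [typeCard_rotate, hrot] at *
  have h2 : 2 ^ (k + 2) = 4 * 2 ^ k := by ring
  rw [h2] at huv' hwu' hvw' hnu hnv hnw
  generalize 2 ^ k = q at *
  generalize typeCard B A u v w 0 0 0 = p000 at *
  generalize typeCard B A u v w 0 0 1 = p001 at *
  generalize typeCard B A u v w 0 1 0 = p010 at *
  generalize typeCard B A u v w 0 1 1 = p011 at *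
  generalize typeCard B A u v w 1 0 0 = p100 at *
  generalize typeCard B A u v w 1 0 1 = p101 at *
  generalize typeCard B A u v w 1 1 0 = p110 at *
  generalize typeCard B A u v w 1 1 1 = p111 at *
  generalize A.card = N at *
  clear hrot h2
  -- If p100 = 0, the two unions with N(u) give p101 > q and p110 > q, against |N(u)| ≤ 2q.
  have h100 : p100 ≠ 0 := by clear hdu hdv hdw hz; omega
  have h010 : p010 ≠ 0 := by clear hdu hdv hdw hz; omega
  have h001 : p001 ≠ 0 := by clear hdu hdv hdw hz; omega
  replace hz := hz h100
  rcases hdu h100 with h | h | h | h <;> rcases hdv h010 with h' | h' | h' | h' <;>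
    rcases hdw h001 with h'' | h'' | h'' | h'' <;> clear hdu hdv hdw <;> omega

end

end

/-! ### A Ramsey bound, and four vectors with isotropic neighbourhoods -/

section

/-- A triangle-free graph on `s` whose independent sets have at most `k` elements has at most
`k * (k + 3) / 2` vertices. -/
theorem two_mul_card_le_of_triangleFree {α : Type*} (r : α → α → Prop)
    (hr : ∀ x y, r x y → r y x) :
    ∀ (k : ℕ) (s : Finset α),
      (∀ x ∈ s, ∀ y ∈ s, ∀ z ∈ s, x ≠ y → x ≠ z → y ≠ z → r x y → r x z → ¬ r y z) →
      (∀ t ⊆ s, (∀ x ∈ t, ∀ y ∈ t, x ≠ y → ¬ r x y) → t.card ≤ k) →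
      2 * s.card ≤ k * (k + 3) := by
  classical
  intro k
  induction k with
  | zero =>
    intro s _ hind
    rcases s.eq_empty_or_nonempty with rfl | ⟨v, hv⟩
    · simp
    · have := hind {v} (by simpa using hv) (by simp)
      simp at this
  | succ k ih =>
    intro s htri hind
    rcases s.eq_empty_or_nonempty with rfl | ⟨v, hv⟩
    · simp
    -- Neighbours of v are independent by triangle-freeness; among the non-neighbours, independent
    -- sets extend by v and so have at most k elements.
    have h1 : ((s.erase v).filter fun y => r v y).card ≤ k + 1 := by
      refine hind _ ((Finset.filter_subset _ _).trans (Finset.erase_subset _ _)) ?_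
      intro x hx y hy hxy
      simp only [Finset.mem_filter, Finset.mem_erase] at hx hy
      exact htri v hv x hx.1.2 y hy.1.2 hx.1.1.symm hy.1.1.symm hxy hx.2 hy.2
    have h2 : 2 * ((s.erase v).filter fun y => ¬ r v y).card ≤ k * (k + 3) := by
      have hsub : ((s.erase v).filter fun y => ¬ r v y) ⊆ s :=
        (Finset.filter_subset _ _).trans (Finset.erase_subset _ _)
      refine ih _ (fun x hx y hy z hz => htri x (hsub hx) y (hsub hy) z (hsub hz)) ?_
      intro t ht hti
      have hvt : ∀ x ∈ t, x ≠ v ∧ ¬ r v x := fun x hx => by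
        have := ht hx
        simp only [Finset.mem_filter, Finset.mem_erase] at this
        exact ⟨this.1.1, this.2⟩
      have hv' : v ∉ t := fun h => (hvt v h).1 rfl
      have := hind (insert v t) (Finset.insert_subset hv (ht.trans hsub)) (by
        intro x hx y hy hxy
        rcases Finset.mem_insert.1 hx with rfl | hx
        · rcases Finset.mem_insert.1 hy with rfl | hy
          · exact absurd rfl hxy
          · exact (hvt y hy).2
        · rcases Finset.mem_insert.1 hy with hyv | hy
          · exact fun h => (hvt x hx).2 (hr _ _ (hyv ▸ h))
          · exact hti x hx y hy hxy)
      rw [Finset.card_insert_of_notMem hv'] at this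
      omega
    have h3 := Finset.card_filter_add_card_filter_not (s := s.erase v) (fun y => r v y)
    have h4 := Finset.card_erase_add_one hv
    have h5 : (k + 1) * (k + 1 + 3) = k * (k + 3) + 2 * k + 4 := by ring
    rw [h5]
    omega

variable {V : Type*} [AddCommGroup V] [Module (ZMod 2) V] [FiniteDimensional (ZMod 2) V]

section
variable {B : LinearMap.BilinForm (ZMod 2) V} {W : Submodule (ZMod 2) V} {m k : ℕ}

/-- I lies in {x, y}^⊥, of dimension 2(k + 1), and z halves the isotropic bound there. -/
theorem IsSymplecticOn.two_mul_card_le_of_orthogonal_pair (hB : ∀ x y, B x y = B y x)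
    (hW : IsSymplecticOn B W (k + 2)) {I : Finset V} (hIW : ∀ a ∈ I, a ∈ W)
    (hI : IsIsotropicSet B I) {x y z : V} (hx : x ∈ W) (hy : y ∈ W) (hxy : B x y = 1)
    (hIx : ∀ a ∈ I, B x a = 0) (hIy : ∀ a ∈ I, B y a = 0) (hIz : ∀ a ∈ I, B z a = 1) :
    I.card ≤ 2 ^ k := by
  obtain ⟨k', hk, hW'⟩ := hW.exists_perpPair hB hx hy hxy
  obtain rfl : k' = k + 1 := by omega
  have := hW'.two_mul_card_isotropic_le hB
    (fun a ha => mem_perpPair.2 ⟨hIW a ha, hIx a ha, hIy a ha⟩) hI z hIz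
  rw [pow_succ] at this
  omega

/-- N(x) \ N(z) is orthogonal to the hyperbolic pair y, z, so it has at most 2^k elements instead of
2^(k+1). -/
theorem IsSymplecticOn.card_le_of_orth_pair_of_nonOrth (hB : ∀ x y, B x y = B y x)
    (hW : IsSymplecticOn B W (k + 2)) {A : Finset V} (hAW : ∀ a ∈ A, a ∈ W) (h0 : (0 : V) ∉ A)
    (hA : IsTriangleFree B A) {x y z : V} (hx : x ∈ W) (hy : y ∈ W) (hz : z ∈ W)
    (hxz : B x z = 1) (hyz : B y z = 1)
    (hNx : IsIsotropicSet B (nonOrth B A x)) (hNz : IsIsotropicSet B (nonOrth B A z))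
    (hdisj : Disjoint (nonOrth B A x) (nonOrth B A y)) : A.card + 2 ≤ 7 * 2 ^ k := by
  classical
  have h1 := hW.card_triangleFree_le_union hB hAW h0 hA hx hz hxz
  have h2 := hW.two_mul_card_nonOrth_le hB hAW hNz
  have hsub : nonOrth B A x \ nonOrth B A z ⊆ nonOrth B A x := Finset.sdiff_subset
  have h3 := hW.two_mul_card_le_of_orthogonal_pair hB (I := nonOrth B A x \ nonOrth B A z)
    (fun a ha => hAW a (mem_nonOrth.1 (hsub ha)).1) (hNx.mono hsub) hy hz hyz
    (fun a ha => zmod_two_ne_one_iff.1 fun h => Finset.disjoint_left.1 hdisj (hsub ha)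
      (mem_nonOrth.2 ⟨(mem_nonOrth.1 (hsub ha)).1, h⟩))
    (fun a ha => zmod_two_ne_one_iff.1 fun h => (Finset.mem_sdiff.1 ha).2
      (mem_nonOrth.2 ⟨(mem_nonOrth.1 (hsub ha)).1, h⟩))
    (z := x) (fun a ha => (mem_nonOrth.1 (hsub ha)).2)
  have h4 : (nonOrth B A x ∪ nonOrth B A z).card =
      (nonOrth B A x \ nonOrth B A z).card + (nonOrth B A z).card := by
    rw [← Finset.sdiff_union_self_eq_union, Finset.card_union_of_disjoint Finset.sdiff_disjoint]
  rw [pow_add] at h1 h2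
  omega

/-- Disjointness makes N(y) orthogonal to the hyperbolic pair x, z, so |N(y)| ≤ 2^k; then count with
the pair y, w. -/
theorem IsSymplecticOn.card_le_of_orth_path (hB : ∀ x y, B x y = B y x)
    (hW : IsSymplecticOn B W (k + 2)) {A : Finset V} (hAW : ∀ a ∈ A, a ∈ W) (h0 : (0 : V) ∉ A)
    (hA : IsTriangleFree B A) {x y z w : V} (hx : x ∈ W) (hy : y ∈ W) (hz : z ∈ W) (hw : w ∈ W)
    (hxz : B x z = 1) (hyw : B y w = 1)
    (hNy : IsIsotropicSet B (nonOrth B A y)) (hNw : IsIsotropicSet B (nonOrth B A w))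
    (hdx : Disjoint (nonOrth B A y) (nonOrth B A x))
    (hdz : Disjoint (nonOrth B A y) (nonOrth B A z)) : A.card + 2 ≤ 7 * 2 ^ k := by
  classical
  have h1 := hW.card_triangleFree_le_union hB hAW h0 hA hy hw hyw
  have h2 := hW.two_mul_card_nonOrth_le hB hAW hNw
  have h3 := hW.two_mul_card_le_of_orthogonal_pair hB (I := nonOrth B A y)
    (fun a ha => hAW a (mem_nonOrth.1 ha).1) hNy hx hz hxz
    (fun a ha => zmod_two_ne_one_iff.1 fun h => Finset.disjoint_left.1 hdx ha
      (mem_nonOrth.2 ⟨(mem_nonOrth.1 ha).1, h⟩))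
    (fun a ha => zmod_two_ne_one_iff.1 fun h => Finset.disjoint_left.1 hdz ha
      (mem_nonOrth.2 ⟨(mem_nonOrth.1 ha).1, h⟩))
    (z := y) (fun a ha => (mem_nonOrth.1 ha).2)
  have h4 := Finset.card_union_le (nonOrth B A y) (nonOrth B A w)
  rw [pow_add] at h1 h2
  omega

/-- No three vectors of U are pairwise orthogonal, so any four of them contain one of the three
configurations treated above. -/
theorem IsSymplecticOn.card_le_of_four (hB : ∀ x y, B x y = B y x)
    (hW : IsSymplecticOn B W (k + 2)) {A : Finset V} (hAW : ∀ a ∈ A, a ∈ W) (h0 : (0 : V) ∉ A)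
    (hA : IsTriangleFree B A) {U : Finset V} (hUW : ∀ u ∈ U, u ∈ W) (hU : 4 ≤ U.card)
    (hN : ∀ u ∈ U, IsIsotropicSet B (nonOrth B A u))
    (hdisj : ∀ u ∈ U, ∀ v ∈ U, u ≠ v → B u v = 0 → Disjoint (nonOrth B A u) (nonOrth B A v))
    (htri : ∀ u ∈ U, ∀ v ∈ U, ∀ w ∈ U, u ≠ v → u ≠ w → v ≠ w →
      B u v = 1 ∨ B u w = 1 ∨ B v w = 1) : A.card + 2 ≤ 7 * 2 ^ k := by
  classical
  have c1 : ∀ u ∈ U, ∀ v ∈ U, ∀ w ∈ U, B u v = 1 → B u w = 1 → B v w = 1 →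
      A.card + 2 ≤ 7 * 2 ^ k := fun u hu v hv w hw huv huw hvw =>
    hW.card_le_of_nonOrth_triple hB hAW h0 hA (hUW u hu) (hUW v hv) (hUW w hw) huv huw hvw
      (hN u hu) (hN v hv) (hN w hw)
  have c2 : ∀ x ∈ U, ∀ y ∈ U, ∀ z ∈ U, x ≠ y → B x y = 0 → B x z = 1 → B y z = 1 →
      A.card + 2 ≤ 7 * 2 ^ k := fun x hx y hy z hz hne hxy hxz hyz =>
    hW.card_le_of_orth_pair_of_nonOrth hB hAW h0 hA (hUW x hx) (hUW y hy) (hUW z hz) hxz hyz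
      (hN x hx) (hN z hz) (hdisj x hx y hy hne hxy)
  have c3 : ∀ x ∈ U, ∀ y ∈ U, ∀ z ∈ U, ∀ w ∈ U, y ≠ x → y ≠ z → B y x = 0 → B y z = 0 →
      B x z = 1 → B y w = 1 → A.card + 2 ≤ 7 * 2 ^ k :=
    fun x hx y hy z hz w hw hne hne' hyx hyz hxz hyw =>
    hW.card_le_of_orth_path hB hAW h0 hA (hUW x hx) (hUW y hy) (hUW z hz) (hUW w hw) hxz hyw
      (hN y hy) (hN w hw) (hdisj y hy x hx hne hyx) (hdisj y hy z hz hne' hyz)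
  clear hdisj hN
  have c : ∀ x ∈ U, ∀ y ∈ U, ∀ z ∈ U, ∀ w ∈ U, x ≠ y → x ≠ z → x ≠ w → y ≠ z → y ≠ w → z ≠ w →
      B x y = 0 → A.card + 2 ≤ 7 * 2 ^ k := by
    intro x hx y hy z hz w hw hxy hxz hxw hyz hyw hzw h
    have hyx : B y x = 0 := by rw [hB, h]
    rcases zmod_two_cases (B x z) with h1 | h1 <;> rcases zmod_two_cases (B y z) with h2 | h2
    · have := htri x hx y hy z hz hxy hxz hyz
      simp [h, h1, h2] at this
    · rcases zmod_two_cases (B x w) with h3 | h3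
      · rcases zmod_two_cases (B y w) with h4 | h4
        · have := htri x hx y hy w hw hxy hxw hyw
          simp [h, h3, h4] at this
        · have := htri x hx z hz w hw hxz hxw hzw
          simp only [h1, h3, zero_ne_one, false_or] at this
          exact c1 y hy z hz w hw h2 h4 this
      · exact c3 y hy x hx z hz w hw hxy hxz h h1 h2 h3
    · rcases zmod_two_cases (B y w) with h4 | h4
      · rcases zmod_two_cases (B x w) with h3 | h3
        · have := htri x hx y hy w hw hxy hxw hyw
          simp [h, h3, h4] at this
        · have := htri y hy z hz w hw hyz hyw hzw
          simp only [h2, h4, zero_ne_one, false_or] at this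
          exact c1 x hx z hz w hw h1 h3 this
      · exact c3 x hx y hy z hz w hw hxy.symm hyz hyx h2 h1 h4
    · exact c2 x hx y hy z hz hxy h h1 h2
  obtain ⟨T, hTU, hT⟩ := Finset.exists_subset_card_eq hU
  obtain ⟨x, y, z, w, hxy, hxz, hxw, hyz, hyw, hzw, rfl⟩ := Finset.card_eq_four.1 hT
  have hx : x ∈ U := hTU (by simp)
  have hy : y ∈ U := hTU (by simp)
  have hz : z ∈ U := hTU (by simp)
  have hw : w ∈ U := hTU (by simp)
  rcases zmod_two_cases (B x y) with h1 | h1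
  · exact c x hx y hy z hz w hw hxy hxz hxw hyz hyw hzw h1
  rcases zmod_two_cases (B x z) with h2 | h2
  · exact c x hx z hz y hy w hw hxz hxy hxw hyz.symm hzw hyw h2
  rcases zmod_two_cases (B y z) with h3 | h3
  · exact c y hy z hz x hx w hw hyz hxy.symm hyw hxz.symm hzw hxw h3
  exact c1 x hx y hy z hz h1 h2 h3

end

end

/-! ### Upper bounds for nondegenerate symmetric forms -/

section

variable {V : Type*} [AddCommGroup V] [Module (ZMod 2) V]

/-- No three distinct vectors of `S` are pairwise non-orthogonal. -/
def IsDistinctTriangleFree (B : LinearMap.BilinForm (ZMod 2) V) (S : Finset V) : Prop :=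
  ∀ x ∈ S, ∀ y ∈ S, ∀ z ∈ S, x ≠ y → x ≠ z → y ≠ z → B x y = 0 ∨ B x z = 0 ∨ B y z = 0

section
variable {B : LinearMap.BilinForm (ZMod 2) V}

theorem isKLOrthogonal_three_two_iff (hB : ∀ x y, B x y = B y x) {S : Finset V} :
    IsKLOrthogonal B 3 2 S ↔ (0 : V) ∉ S ∧ IsDistinctTriangleFree B S := by
  classical
  refine and_congr_right fun _ => ⟨?_, ?_⟩
  · intro h x hx y hy z hz hxy hxz hyz
    obtain ⟨U, hUT, hU, hort⟩ := h {x, y, z}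
      (by simp [Finset.insert_subset_iff, hx, hy, hz])
      (Finset.card_eq_three.2 ⟨x, y, z, hxy, hxz, hyz, rfl⟩)
    obtain ⟨a, b, hab, rfl⟩ := Finset.card_eq_two.1 hU
    have hab0 : B a b = 0 := hort (by simp) (by simp) hab
    have hba0 : B b a = 0 := by rw [hB, hab0]
    have ha : a ∈ ({x, y, z} : Finset V) := hUT (by simp)
    have hb : b ∈ ({x, y, z} : Finset V) := hUT (by simp)
    simp only [Finset.mem_insert, Finset.mem_singleton] at ha hb
    rcases ha with rfl | rfl | rfl <;> rcases hb with rfl | rfl | rfl <;> tauto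
  · intro h T hTS hT
    obtain ⟨x, y, z, hxy, hxz, hyz, rfl⟩ := Finset.card_eq_three.1 hT
    have key : ∀ a b, a ∈ ({x, y, z} : Finset V) → b ∈ ({x, y, z} : Finset V) → a ≠ b →
        B a b = 0 → ∃ U : Finset V, U ⊆ {x, y, z} ∧ U.card = 2 ∧
          (U : Set V).Pairwise (fun x y => B x y = 0) := by
      intro a b ha hb hab h0
      refine ⟨{a, b}, by simp only [Finset.insert_subset_iff, Finset.singleton_subset_iff, ha, hb,
        and_self], Finset.card_pair hab, ?_⟩
      rw [Finset.coe_pair, Set.pairwise_pair]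
      exact fun _ => ⟨h0, by rw [hB, h0]⟩
    rcases h x (hTS (by simp)) y (hTS (by simp)) z (hTS (by simp)) hxy hxz hyz with h | h | h
    · exact key x y (by simp) (by simp) hxy h
    · exact key x z (by simp) (by simp) hxz h
    · exact key y z (by simp) (by simp) hyz h

theorem IsDistinctTriangleFree.mono {S T : Finset V} (h : IsDistinctTriangleFree B T)
    (hST : S ⊆ T) : IsDistinctTriangleFree B S :=
  fun x hx y hy z hz => h x (hST hx) y (hST hy) z (hST hz)

theorem IsDistinctTriangleFree.isTriangleFree {S : Finset V}
    (h : IsDistinctTriangleFree B S) (halt : ∀ x ∈ S, B x x = 0) : IsTriangleFree B S := by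
  intro x hx y hy z hz
  by_cases hxy : x = y
  · exact Or.inl (hxy ▸ halt x hx)
  by_cases hxz : x = z
  · exact Or.inr (Or.inl (hxz ▸ halt x hx))
  by_cases hyz : y = z
  · exact Or.inr (Or.inr (hyz ▸ halt y hy))
  exact h x hx y hy z hz hxy hxz hyz

theorem IsDistinctTriangleFree.isIsotropicSet_nonOrth {S A : Finset V}
    (h : IsDistinctTriangleFree B S) (hAS : A ⊆ S) (halt : ∀ x ∈ A, B x x = 0) {u : V}
    (hu : u ∈ S) (huA : u ∉ A) : IsIsotropicSet B (nonOrth B A u) := by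
  intro x hx y hy
  rw [mem_nonOrth] at hx hy
  by_cases hxy : x = y
  · exact hxy ▸ halt x hx.1
  have hux : u ≠ x := fun h => huA (h ▸ hx.1)
  have huy : u ≠ y := fun h => huA (h ▸ hy.1)
  simpa [hx.2, hy.2] using h u hu x (hAS hx.1) y (hAS hy.1) hux huy hxy

theorem card_filter_ker_add (e : V) (S : Finset V) :
    S.card = (S.filter fun a => B e a = 0).card + (S.filter fun a => B e a = 1).card := by
  have h := card_filter_add_card_filter S (fun _ => True) (B e)
  simpa only [Finset.filter_true, true_and] using h

variable [FiniteDimensional (ZMod 2) V]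

theorem card_le_finrank_of_orthonormal {O : Finset V} (h1 : ∀ x ∈ O, B x x = 1)
    (h0 : ∀ x ∈ O, ∀ y ∈ O, x ≠ y → B x y = 0) : O.card ≤ Module.finrank (ZMod 2) V := by
  have h := LinearMap.BilinForm.linearIndependent_of_iIsOrtho (B := B)
    (v := fun x : O => (x : V)) (LinearMap.BilinForm.iIsOrtho_def.2 fun i j hij =>
      h0 i i.2 j j.2 fun h => hij (Subtype.ext h))
    (fun i => by simp [h1 i i.2])
  simpa using h.fintype_card_le_finrank

/-- Independent sets of the non-orthogonality graph are orthonormal, hence linearly independent. -/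
theorem IsDistinctTriangleFree.two_mul_card_le (hB : ∀ x y, B x y = B y x) {O : Finset V}
    (h : IsDistinctTriangleFree B O) (h1 : ∀ x ∈ O, B x x = 1) :
    2 * O.card ≤ Module.finrank (ZMod 2) V * (Module.finrank (ZMod 2) V + 3) := by
  refine two_mul_card_le_of_triangleFree (fun x y => B x y = 1)
    (fun x y hxy => by rw [hB, hxy]) _ O ?_ ?_
  · intro x hx y hy z hz hxy hxz hyz h1 h2 h3
    have := h x hx y hy z hz hxy hxz hyz
    simp [h1, h2, h3] at this
  · intro t ht hti
    exact card_le_finrank_of_orthonormal (B := B) (fun x hx => h1 x (ht hx))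
      fun x hx y hy hxy => zmod_two_ne_one_iff.1 (hti x hx y hy hxy)

theorem isSymplecticOn_ker {m : ℕ} (hB : ∀ x y, B x y = B y x)
    (hnd : ∀ x, (∀ y, B x y = 0) → x = 0) {e : V} (he : ∀ x, B x x = B e x) (hee : B e e = 1)
    (hn : Module.finrank (ZMod 2) V = 2 * m + 1) :
    IsSymplecticOn B (LinearMap.ker (B e)) m where
  alt x hx := by rw [he, LinearMap.mem_ker.1 hx]
  nondeg x hx h := by
    refine hnd x fun y => ?_
    have := h (y + B e y • e) (by simp [hee, CharTwo.add_self_eq_zero])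
    rw [map_add, map_smul, hB x e, LinearMap.mem_ker.1 hx] at this
    simpa using this
  finrank := by
    have h : B e ≠ 0 := fun h => by simp [h] at hee
    have := Module.Dual.finrank_ker_add_one_of_ne_zero h
    omega

/-- This is a concrete model of the quotient e^⊥/⟨e⟩: u selects one representative in each coset of
e. -/
theorem isSymplecticOn_perpPair_top {m : ℕ} (hB : ∀ x y, B x y = B y x)
    (hnd : ∀ x, (∀ y, B x y = 0) → x = 0) {e u : V} (he : ∀ x, B x x = B e x) (hee : B e e = 0)
    (heu : B e u = 1) (hn : Module.finrank (ZMod 2) V = 2 * m + 2) :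
    IsSymplecticOn B (perpPair B ⊤ e u) m where
  alt x hx := by rw [he, (mem_perpPair.1 hx).2.1]
  nondeg x hx h := by
    obtain ⟨_, h1, h2⟩ := mem_perpPair.1 hx
    have huu : B u u = 1 := by rw [he, heu]
    have hue : B u e = 1 := by rw [hB, heu]
    refine hnd x fun y => ?_
    have := h (y + (B u y + B e y) • e + B e y • u) (mem_perpPair.2 ⟨trivial,
      by simp [hee, heu, CharTwo.add_self_eq_zero], by
        simp only [map_add, map_smul, hue, huu, smul_eq_mul, mul_one]
        generalize B u y = a
        generalize B e y = b
        revert a b; decide⟩)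
    simpa [hB x e, hB x u, h1, h2] using this
  finrank := by
    have h := finrank_perpPair_add_two (B := B) (W := ⊤) (x := e) (y := u) (p := u + e) (q := e)
      trivial trivial (by simp [hee, heu]) (by
        rw [map_add, he, heu, hB u e, heu]; decide) hee (by rw [hB, heu])
    rw [finrank_top] at h
    omega

/-- The Ramsey bound for O against the available room; the estimate fails at k = 7, whence n ≥ 21.
-/
theorem card_odd_part_bound {k : ℕ} (hk : 8 ≤ k) : (2 * k + 5) * (2 * k + 8) ≤ 2 * 2 ^ k + 6 := by
  induction k, hk using Nat.le_induction with
  | base => norm_num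
  | succ k hk ih => rw [pow_succ]; nlinarith

theorem card_even_part_bound {k : ℕ} (hk : 8 ≤ k) : (2 * k + 2) * (2 * k + 5) + 2 ≤ 2 * 2 ^ k := by
  induction k, hk using Nat.le_induction with
  | base => norm_num
  | succ k hk ih => rw [pow_succ]; nlinarith

/-- Adding e moves O into the symplectic space e^⊥ without changing neighbourhoods in A, and flips
orthogonality within O. So triangle-freeness of O says that no three translates are pairwise
orthogonal. -/
theorem IsDistinctTriangleFree.card_le_of_odd {m : ℕ} (hm : 10 ≤ m) (hB : ∀ x y, B x y = B y x)
    (hnd : ∀ x, (∀ y, B x y = 0) → x = 0) {e : V} (he : ∀ x, B x x = B e x) (hee : B e e = 1)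
    (hn : Module.finrank (ZMod 2) V = 2 * m + 1) {S : Finset V} (h0 : (0 : V) ∉ S)
    (hS : IsDistinctTriangleFree B S) : S.card ≤ 2 ^ (m + 1) + 1 := by
  classical
  obtain ⟨k, rfl⟩ : ∃ k, m = k + 2 := ⟨m - 2, by omega⟩
  have hW := isSymplecticOn_ker hB hnd he hee hn
  rw [card_filter_ker_add (B := B) e S]
  set A := S.filter fun a => B e a = 0 with hA
  set O := S.filter fun a => B e a = 1 with hO
  have hAS : A ⊆ S := Finset.filter_subset _ _
  have hOS : O ⊆ S := Finset.filter_subset _ _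
  have hAe : ∀ a ∈ A, B e a = 0 := fun a ha => (Finset.mem_filter.1 ha).2
  have hOe : ∀ a ∈ O, B e a = 1 := fun a ha => (Finset.mem_filter.1 ha).2
  have hAW : ∀ a ∈ A, a ∈ LinearMap.ker (B e) := hAe
  have halt : ∀ a ∈ A, B a a = 0 := fun a ha => by rw [he, hAe a ha]
  have hAtf : IsTriangleFree B A := (hS.mono hAS).isTriangleFree halt
  have h0A : (0 : V) ∉ A := fun h => h0 (hAS h)
  have hOA : ∀ o ∈ O, o ∉ A := fun o ho h => by
    have := hAe o h
    rw [hOe o ho] at this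
    exact one_ne_zero this
  have hO2 := (hS.mono hOS).two_mul_card_le hB fun x hx => by rw [he, hOe x hx]
  rw [hn] at hO2
  by_cases hcard : O.card ≤ 3
  · have := hW.card_triangleFree_le hB hAW h0A hAtf
    omega
  have hNeq : ∀ o, nonOrth B A (o + e) = nonOrth B A o := fun o =>
    Finset.filter_congr fun a ha => by simp [hAe a ha]
  have hBadd : ∀ o ∈ O, ∀ o' ∈ O, B (o + e) (o' + e) = B o o' + 1 := fun o ho o' ho' => by
    rw [map_add, map_add, LinearMap.add_apply, LinearMap.add_apply, hB o e, hOe o ho, hOe o' ho',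
      hee, CharTwo.add_self_eq_zero, add_zero]
  have hinj : Function.Injective fun a : V => a + e := add_left_injective e
  have h := hW.card_le_of_four hB hAW h0A hAtf (U := O.image fun a => a + e) ?_ ?_ ?_ ?_ ?_
  · have := card_odd_part_bound (k := k) (by omega)
    have h2 : 2 ^ (k + 2 + 1) = 8 * 2 ^ k := by ring
    have h3 : (2 * (k + 2) + 1) * (2 * (k + 2) + 1 + 3) = (2 * k + 5) * (2 * k + 8) := by ring
    rw [h2]
    rw [h3] at hO2
    omega
  · intro u hu
    obtain ⟨o, ho, rfl⟩ := Finset.mem_image.1 hu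
    rw [LinearMap.mem_ker, map_add, hee, hOe o ho, CharTwo.add_self_eq_zero]
  · rw [Finset.card_image_of_injective _ hinj]
    omega
  · intro u hu
    obtain ⟨o, ho, rfl⟩ := Finset.mem_image.1 hu
    rw [hNeq]
    exact hS.isIsotropicSet_nonOrth hAS halt (hOS ho) (hOA o ho)
  · intro u hu v hv huv h
    obtain ⟨o, ho, rfl⟩ := Finset.mem_image.1 hu
    obtain ⟨o', ho', rfl⟩ := Finset.mem_image.1 hv
    have hne : o ≠ o' := fun h => huv (by rw [h])
    -- Here o and o' are non-orthogonal, so a common neighbour in A would close a triangle in S.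
    rw [hBadd o ho o' ho', CharTwo.add_eq_zero] at h
    rw [hNeq, hNeq, Finset.disjoint_left]
    intro a ha ha'
    obtain ⟨haA, ha⟩ := mem_nonOrth.1 ha
    obtain ⟨_, ha'⟩ := mem_nonOrth.1 ha'
    have := hS o (hOS ho) o' (hOS ho') a (hAS haA) hne (fun h => hOA o ho (h ▸ haA))
      (fun h => hOA o' ho' (h ▸ haA))
    simp [h, ha, ha'] at this
  · intro u hu v hv w hw huv huw hvw
    obtain ⟨o, ho, rfl⟩ := Finset.mem_image.1 hu
    obtain ⟨o', ho', rfl⟩ := Finset.mem_image.1 hv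
    obtain ⟨o'', ho'', rfl⟩ := Finset.mem_image.1 hw
    rw [hBadd o ho o' ho', hBadd o ho o'' ho'', hBadd o' ho' o'' ho'']
    simp only [add_eq_right]
    exact hS o (hOS ho) o' (hOS ho') o'' (hOS ho'') (fun h => huv (by rw [h]))
      (fun h => huw (by rw [h])) (fun h => hvw (by rw [h]))

theorem IsDistinctTriangleFree.card_le_of_even {k : ℕ} (hk : 8 ≤ k) (hB : ∀ x y, B x y = B y x)
    (hnd : ∀ x, (∀ y, B x y = 0) → x = 0) {e : V} (he : ∀ x, B x x = B e x) (he0 : e ≠ 0)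
    (hee : B e e = 0) (hn : Module.finrank (ZMod 2) V = 2 * k + 2) {S : Finset V}
    (h0 : (0 : V) ∉ S) (hS : IsDistinctTriangleFree B S) : S.card + 3 ≤ 2 ^ (k + 2) := by
  classical
  have hpow : 2 ^ (k + 2) = 4 * 2 ^ k := by ring
  have hpow' : 2 ^ (k + 1) = 2 * 2 ^ k := by ring
  rw [card_filter_ker_add (B := B) e S]
  set A := S.filter fun a => B e a = 0 with hA
  set O := S.filter fun a => B e a = 1 with hO
  have hAS : A ⊆ S := Finset.filter_subset _ _
  have hOS : O ⊆ S := Finset.filter_subset _ _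
  have hAe : ∀ a ∈ A, B e a = 0 := fun a ha => (Finset.mem_filter.1 ha).2
  have hOe : ∀ a ∈ O, B e a = 1 := fun a ha => (Finset.mem_filter.1 ha).2
  have halt : ∀ a ∈ A, B a a = 0 := fun a ha => by rw [he, hAe a ha]
  have hAtf : IsTriangleFree B A := (hS.mono hAS).isTriangleFree halt
  have h0A : (0 : V) ∉ A := fun h => h0 (hAS h)
  have hBadd : ∀ a ∈ A, ∀ b ∈ A, B (a + e) (b + e) = B a b := fun a ha b hb => by
    rw [map_add, map_add, LinearMap.add_apply, LinearMap.add_apply, hB a e, hAe a ha, hAe b hb,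
      hee, add_zero, add_zero, add_zero]
  have hinj : Function.Injective fun a : V => a + e := add_left_injective e
  have hmem : ∀ u, B e u = 1 → ∀ a ∈ A, B u a = 1 → a + e ∈ perpPair B ⊤ e u :=
    fun u hu a ha hua => mem_perpPair.2 ⟨trivial, by rw [map_add, hAe a ha, hee, add_zero],
      by rw [map_add, hua, hB u e, hu, CharTwo.add_self_eq_zero]⟩
  -- One half of A lies in {e, u}^⊥ already; the other half enters it after translation by e.
  have hzero : ∀ u, B e u = 1 → (A.filter fun a => B u a = 0).card + 2 ≤ 2 ^ (k + 1) :=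
    fun u hu => (isSymplecticOn_perpPair_top hB hnd he hee hu hn).card_triangleFree_le hB
      (fun a ha => by
        rw [Finset.mem_filter] at ha
        exact mem_perpPair.2 ⟨trivial, hAe a ha.1, ha.2⟩)
      (fun h => h0A (Finset.mem_filter.1 h).1) (hAtf.mono (Finset.filter_subset _ _))
  rcases O.eq_empty_or_nonempty with hOempty | ⟨u, huO⟩
  · obtain ⟨u, hu⟩ : ∃ u, B e u ≠ 0 := by
      by_contra! h
      exact he0 (hnd e h)
    replace hu := zmod_two_eq_one_of_ne_zero hu
    -- The vector e is set aside because its translate is 0; it accounts for the bound 2(2^(k+1) -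
    -- 2) + 1.
    have hsub : ∀ a ∈ (nonOrth B A u).erase e, a ∈ A ∧ B u a = 1 := fun a ha =>
      mem_nonOrth.1 (Finset.mem_of_mem_erase ha)
    have h1 := (isSymplecticOn_perpPair_top hB hnd he hee hu hn).card_triangleFree_le hB
      (A := ((nonOrth B A u).erase e).image fun a => a + e) ?_ ?_ ?_
    · rw [Finset.card_image_of_injective _ hinj] at h1
      have h2 := Finset.pred_card_le_card_erase (s := nonOrth B A u) (a := e)
      rw [card_filter_ker_add (B := B) u A, hOempty, Finset.card_empty]
      have := hzero u hu
      rw [nonOrth] at h1 h2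
      omega
    · intro x hx
      obtain ⟨a, ha, rfl⟩ := Finset.mem_image.1 hx
      exact hmem u hu a (hsub a ha).1 (hsub a ha).2
    · intro h
      obtain ⟨a, ha, h⟩ := Finset.mem_image.1 h
      refine Finset.ne_of_mem_erase ha ?_
      have := congrArg (· + e) h
      simpa [add_assoc, add_self_eq_zero_of_zmod_two] using this
    · intro x hx y hy z hz
      obtain ⟨a, ha, rfl⟩ := Finset.mem_image.1 hx
      obtain ⟨b, hb, rfl⟩ := Finset.mem_image.1 hy
      obtain ⟨c, hc, rfl⟩ := Finset.mem_image.1 hz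
      have ha := (hsub a ha).1
      have hb := (hsub b hb).1
      have hc := (hsub c hc).1
      rw [hBadd a ha b hb, hBadd a ha c hc, hBadd b hb c hc]
      exact hAtf a ha b hb c hc
  · have hu := hOe u huO
    have huA : u ∉ A := fun h => by
      have := hAe u h
      rw [hu] at this
      exact one_ne_zero this
    have hiso := hS.isIsotropicSet_nonOrth hAS halt (hOS huO) huA
    have h1 := (isSymplecticOn_perpPair_top hB hnd he hee hu hn).card_isotropic_le hB
      (I := (nonOrth B A u).image fun a => a + e) ?_ ?_
    · have hO2 := (hS.mono hOS).two_mul_card_le hB fun x hx => by rw [he, hOe x hx]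
      rw [hn] at hO2
      rw [Finset.card_image_of_injective _ hinj, nonOrth] at h1
      rw [card_filter_ker_add (B := B) u A]
      have := hzero u hu
      have := card_even_part_bound hk
      have h3 : (2 * k + 2) * (2 * k + 2 + 3) = (2 * k + 2) * (2 * k + 5) := by ring
      rw [h3] at hO2
      omega
    · intro x hx
      obtain ⟨a, ha, rfl⟩ := Finset.mem_image.1 hx
      exact hmem u hu a (mem_nonOrth.1 ha).1 (mem_nonOrth.1 ha).2
    · intro x hx y hy
      obtain ⟨a, ha, rfl⟩ := Finset.mem_image.1 hx
      obtain ⟨b, hb, rfl⟩ := Finset.mem_image.1 hy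
      rw [hBadd a (mem_nonOrth.1 ha).1 b (mem_nonOrth.1 hb).1]
      exact hiso a ha b hb

end

end

/-! ### Large sets from pairs of isotropic sets -/

section
variable {V : Type*} [AddCommGroup V] [Module (ZMod 2) V] {B : LinearMap.BilinForm (ZMod 2) V}

theorem IsKLOrthogonal.mono {F V : Type*} [Field F] [AddCommGroup V] [Module F V]
    {B : LinearMap.BilinForm F V} {k l : ℕ} {S T : Finset V} (h : IsKLOrthogonal B k l T)
    (hST : S ⊆ T) : IsKLOrthogonal B k l S :=
  ⟨fun h0 => h.1 (hST h0), fun U hU => h.2 U (hU.trans hST)⟩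

theorem IsKLOrthogonal.exists_card_eq {F V : Type*} [Field F] [AddCommGroup V] [Module F V]
    {B : LinearMap.BilinForm F V} {k l N : ℕ} {T : Finset V} (h : IsKLOrthogonal B k l T)
    (hN : N ≤ T.card) : ∃ S : Finset V, IsKLOrthogonal B k l S ∧ S.card = N := by
  obtain ⟨S, hST, hS⟩ := Finset.exists_subset_card_eq hN
  exact ⟨S, h.mono hST, hS⟩

/-- Among three vectors of X ∪ Y, two lie in the same isotropic set. -/
theorem exists_isKLOrthogonal_of_isotropic_pair [DecidableEq V] (hB : ∀ x y, B x y = B y x)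
    {X Y : Finset V} {m c N : ℕ} (hX : IsIsotropicSet B X) (hY : IsIsotropicSet B Y)
    (hXc : X.card = 2 ^ m) (hYc : Y.card = 2 ^ m) (hXY : (X ∩ Y).card ≤ c)
    (hN : N + c + 1 ≤ 2 ^ (m + 1)) : ∃ S : Finset V, IsKLOrthogonal B 3 2 S ∧ S.card = N := by
  refine IsKLOrthogonal.exists_card_eq (T := (X ∪ Y).erase 0)
    ((isKLOrthogonal_three_two_iff hB).2 ⟨Finset.notMem_erase _ _, ?_⟩) ?_
  · intro x hx y hy z hz _ _ _
    have hx := Finset.mem_union.1 (Finset.mem_of_mem_erase hx)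
    have hy := Finset.mem_union.1 (Finset.mem_of_mem_erase hy)
    have hz := Finset.mem_union.1 (Finset.mem_of_mem_erase hz)
    have h1 := hX x
    have h2 := hX y
    have h3 := hY x
    have h4 := hY y
    grind
  · have h1 := Finset.card_union_add_card_inter X Y
    have h2 := Finset.pred_card_le_card_erase (s := X ∪ Y) (a := 0)
    rw [pow_succ] at hN
    omega

/-- The extra vectors are e, e + u, e + v. The vector e + u is orthogonal to X and e + v to Y, so a
triangle must contain e. But e is orthogonal to X ∪ Y, and the only other vectors it meets, e + u
and e + v, are orthogonal since B(e, e) = B(u, v) = 1. -/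
theorem exists_isKLOrthogonal_of_isotropic_pair_of_odd [DecidableEq V]
    (hB : ∀ x y, B x y = B y x) {X Y : Finset V} {m : ℕ} (hX : IsIsotropicSet B X)
    (hY : IsIsotropicSet B Y) (hXc : X.card = 2 ^ m) (hYc : Y.card = 2 ^ m)
    (hXY : (X ∩ Y).card ≤ 1) {e u v : V} (hee : B e e = 1) (hXe : ∀ x ∈ X, B e x = 0)
    (hYe : ∀ y ∈ Y, B e y = 0) (hu : u ∈ X) (hv : v ∈ Y) (huv : B u v = 1) :
    ∃ S : Finset V, IsKLOrthogonal B 3 2 S ∧ S.card = 2 ^ (m + 1) + 1 := by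
  have heu := hXe u hu
  have hev := hYe v hv
  have huu := hX u hu u hu
  have hvv := hY v hv v hv
  have hue : B u e = 0 := by rw [hB, heu]
  set P := insert (e + u) X with hP
  set Q := insert (e + v) Y with hQ
  have hPi : ∀ p ∈ P, ∀ q ∈ P, p ≠ q → B p q = 0 := by
    intro p hp q hq hpq
    rcases Finset.mem_insert.1 hp with rfl | hp' <;> rcases Finset.mem_insert.1 hq with rfl | hq'
    · exact absurd rfl hpq
    · simp [hXe q hq', hX u hu q hq']
    · simp [hB p e, hXe p hp', hX p hp' u hu]
    · exact hX p hp' q hq'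
  have hQi : ∀ p ∈ Q, ∀ q ∈ Q, p ≠ q → B p q = 0 := by
    intro p hp q hq hpq
    rcases Finset.mem_insert.1 hp with rfl | hp' <;> rcases Finset.mem_insert.1 hq with rfl | hq'
    · exact absurd rfl hpq
    · simp [hYe q hq', hY v hv q hq']
    · simp [hB p e, hYe p hp', hY p hp' v hv]
    · exact hY p hp' q hq'
  have hPQ : ∀ p ∈ P, ∀ q ∈ Q, B e p = 0 ∨ B e q = 0 ∨ B p q = 0 := by
    intro p hp q hq
    rcases Finset.mem_insert.1 hp with rfl | hp' <;> rcases Finset.mem_insert.1 hq with rfl | hq'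
    · exact Or.inr (Or.inr (by simp [hee, hev, hue, huv, CharTwo.add_self_eq_zero]))
    · exact Or.inr (Or.inl (hYe q hq'))
    · exact Or.inl (hXe p hp')
    · exact Or.inl (hXe p hp')
  refine IsKLOrthogonal.exists_card_eq (T := (X ∪ Y).erase 0 ∪ {e, e + u, e + v})
    ((isKLOrthogonal_three_two_iff hB).2 ⟨?_, ?_⟩) ?_
  · simp only [Finset.mem_union, Finset.mem_erase, ne_eq, not_true, false_and, false_or,
      Finset.mem_insert, Finset.mem_singleton]
    rintro (h | h | h) <;> have := congrArg (B e) h <;> simp [hee, heu, hev] at this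
  · have hmem : ∀ x ∈ (X ∪ Y).erase 0 ∪ {e, e + u, e + v}, x ∈ P ∨ x ∈ Q ∨ x = e := by
      intro x hx
      simp only [Finset.mem_union, Finset.mem_erase, Finset.mem_insert,
        Finset.mem_singleton] at hx
      simp only [hP, hQ, Finset.mem_insert]
      tauto
    intro x hx y hy z hz hxy hxz hyz
    have hx := hmem x hx
    have hy := hmem y hy
    have hz := hmem z hz
    clear_value P Q
    clear hmem
    have h1 := hB x e
    have h2 := hB y e
    have h3 := hB z e
    have h4 := hB y x
    have h5 := hB z x
    have h6 := hB z y
    rcases hx with hx | hx | rfl <;> rcases hy with hy | hy | rfl <;>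
      rcases hz with hz | hz | rfl <;> grind
  · have h1 := Finset.card_union_add_card_inter X Y
    have h2 := Finset.pred_card_le_card_erase (s := X ∪ Y) (a := 0)
    have h3 : ({e, e + u, e + v} : Finset V).card = 3 := by
      refine Finset.card_eq_three.2 ⟨e, e + u, e + v, ?_, ?_, ?_, rfl⟩
      · intro h
        rw [left_eq_add.1 h] at huv
        simp at huv
      · intro h
        rw [left_eq_add.1 h] at huv
        simp at huv
      · intro h
        rw [add_left_cancel h, hvv] at huv
        exact zero_ne_one huv
    have h4 : Disjoint ((X ∪ Y).erase 0) {e, e + u, e + v} := by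
      rw [Finset.disjoint_left]
      intro x hx hx'
      have : B e x = 0 := by
        rcases Finset.mem_union.1 (Finset.mem_of_mem_erase hx) with h | h
        · exact hXe x h
        · exact hYe x h
      simp only [Finset.mem_insert, Finset.mem_singleton] at hx'
      rcases hx' with rfl | rfl | rfl <;> simp [hee, heu, hev] at this
    rw [Finset.card_union_of_disjoint h4, h3, pow_succ]
    omega

end

/-! ### The two forms in coordinates, and the extremal sets -/

/-- The other element of the block `{2b, 2b+1}` containing an index. -/
def blockSwap {n : ℕ} (hn : Even n) (i : Fin n) : Fin n :=
  ⟨if (i : ℕ) % 2 = 0 then i + 1 else i - 1, by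
    obtain ⟨m, rfl⟩ := hn
    have := i.isLt
    split <;> omega⟩

theorem val_blockSwap {n : ℕ} (hn : Even n) (i : Fin n) :
    (blockSwap hn i : ℕ) = if (i : ℕ) % 2 = 0 then (i : ℕ) + 1 else i - 1 := rfl

theorem blockSwap_ne {n : ℕ} (hn : Even n) (i : Fin n) : blockSwap hn i ≠ i := by
  intro h
  have := congrArg Fin.val h
  rw [val_blockSwap] at this
  split at this <;> omega

theorem blockSwap_div {n : ℕ} (hn : Even n) (i : Fin n) :
    (blockSwap hn i : ℕ) / 2 = i / 2 := by
  rw [val_blockSwap]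
  split <;> omega

theorem blockSwap_blockSwap {n : ℕ} (hn : Even n) (i : Fin n) :
    blockSwap hn (blockSwap hn i) = i := by
  ext
  rw [val_blockSwap, val_blockSwap]
  split <;> split <;> omega

theorem sum_eq_zero_of_blockSwap {n : ℕ} (hn : Even n) (g : Fin n → ZMod 2)
    (h : ∀ i, g (blockSwap hn i) = g i) : ∑ i, g i = 0 :=
  Finset.sum_involution (fun i _ => blockSwap hn i)
    (fun i _ => by rw [h, CharTwo.add_self_eq_zero]) (fun i _ _ => blockSwap_ne hn i)
    (fun _ _ => Finset.mem_univ _) (fun i _ => blockSwap_blockSwap hn i)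

theorem hyperbolicForm_apply {n : ℕ} (hn : Even n) (x y : Fin n → ZMod 2) :
    hyperbolicForm n x y = ∑ i, x i * y (blockSwap hn i) := by
  rw [hyperbolicForm, Matrix.toBilin'_apply', dotProduct]
  refine Finset.sum_congr rfl fun i _ => ?_
  rw [Matrix.mulVec, dotProduct, Finset.sum_eq_single (blockSwap hn i)]
  · simp [hyperbolicMatrix, blockSwap_div, (blockSwap_ne hn i).symm]
  · intro j _ hj
    rw [hyperbolicMatrix, if_neg, zero_mul]
    rintro ⟨h1, h2⟩
    refine hj (Fin.ext ?_)
    have h3 : (i : ℕ) ≠ j := fun h => h2 (Fin.ext h)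
    rw [val_blockSwap]
    split <;> omega
  · simp

theorem hyperbolicForm_self {n : ℕ} (hn : Even n) (x : Fin n → ZMod 2) :
    hyperbolicForm n x x = 0 := by
  rw [hyperbolicForm_apply hn]
  exact sum_eq_zero_of_blockSwap hn _ fun i => by rw [blockSwap_blockSwap, mul_comm]

theorem hyperbolicForm_comm {n : ℕ} (hn : Even n) (x y : Fin n → ZMod 2) :
    hyperbolicForm n x y = hyperbolicForm n y x := by
  have h := hyperbolicForm_self hn (x + y)
  simpa [hyperbolicForm_self hn, CharTwo.add_eq_zero] using h

theorem isSymplecticOn_hyperbolicForm (m : ℕ) :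
    IsSymplecticOn (hyperbolicForm (2 * m)) ⊤ m where
  alt x _ := hyperbolicForm_self (even_two_mul m) x
  nondeg x _ h := by
    ext i
    have := h (Pi.single (blockSwap (even_two_mul m) i) 1) trivial
    rw [hyperbolicForm_apply (even_two_mul m), Finset.sum_eq_single i] at this
    · simpa using this
    · intro j _ hj
      rw [Pi.single_apply, if_neg, mul_zero]
      exact fun h => hj (by
        rw [← blockSwap_blockSwap (even_two_mul m) j, h, blockSwap_blockSwap])
    · simp
  finrank := by simp

theorem dotForm_apply (n : ℕ) (x y : Fin n → ZMod 2) : dotForm n x y = ∑ i, x i * y i := by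
  rw [dotForm, Matrix.toBilin'_apply', Matrix.one_mulVec, dotProduct]

theorem dotForm_comm (n : ℕ) (x y : Fin n → ZMod 2) : dotForm n x y = dotForm n y x := by
  simp only [dotForm_apply, mul_comm]

theorem dotForm_nondegenerate (n : ℕ) (x : Fin n → ZMod 2) (h : ∀ y, dotForm n x y = 0) :
    x = 0 := by
  ext i
  simpa [dotForm_apply, Pi.single_apply] using h (Pi.single i 1)

theorem dotForm_self (n : ℕ) (x : Fin n → ZMod 2) : dotForm n x x = dotForm n 1 x := by
  rw [dotForm_apply, dotForm_apply]
  refine Finset.sum_congr rfl fun i _ => ?_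
  rw [Pi.one_apply]
  generalize x i = a
  revert a
  decide

theorem dotForm_one_one (n : ℕ) : dotForm n 1 1 = n := by
  simp [dotForm_apply]

/-- The vector of length `2 * m` in which each entry of `a` is repeated twice in a row. -/
def doubled {m : ℕ} (a : Fin m → ZMod 2) : Fin (2 * m) → ZMod 2 :=
  fun i => a ⟨i / 2, by omega⟩

theorem doubled_injective {m : ℕ} : Function.Injective (doubled (m := m)) := by
  intro a b h
  ext i
  have := congrFun h ⟨2 * i, by omega⟩
  simpa [doubled] using this

theorem doubled_blockSwap {m : ℕ} (a : Fin m → ZMod 2) (i : Fin (2 * m)) :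
    doubled a (blockSwap (even_two_mul m) i) = doubled a i := by
  simp only [doubled, blockSwap_div]

theorem sum_doubled_mul_doubled {m : ℕ} (a b : Fin m → ZMod 2) :
    ∑ i, doubled a i * doubled b i = 0 :=
  sum_eq_zero_of_blockSwap (even_two_mul m) _ fun i => by
    rw [doubled_blockSwap, doubled_blockSwap]

theorem card_image_univ_of_injective {m n : ℕ} {f : (Fin m → ZMod 2) → (Fin n → ZMod 2)}
    (hf : Function.Injective f) : (Finset.univ.image f).card = 2 ^ m := by
  rw [Finset.card_image_of_injective _ hf, Finset.card_univ, Fintype.card_fun, ZMod.card,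
    Fintype.card_fin]

theorem isIsotropicSet_image_univ {m n : ℕ} {B : LinearMap.BilinForm (ZMod 2) (Fin n → ZMod 2)}
    {f : (Fin m → ZMod 2) → (Fin n → ZMod 2)} (hf : ∀ a b, B (f a) (f b) = 0) :
    IsIsotropicSet B (Finset.univ.image f) := by
  intro x hx y hy
  obtain ⟨a, _, rfl⟩ := Finset.mem_image.1 hx
  obtain ⟨b, _, rfl⟩ := Finset.mem_image.1 hy
  exact hf a b

/-- The vector of length `2 * m` with the entries of `a` at the indices of residue `p` modulo `2`
and zeros elsewhere. -/
def spread {m : ℕ} (p : ℕ) (a : Fin m → ZMod 2) : Fin (2 * m) → ZMod 2 :=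
  fun i => if (i : ℕ) % 2 = p then doubled a i else 0

theorem spread_injective {m p : ℕ} (hp : p < 2) : Function.Injective (spread (m := m) p) := by
  intro a b h
  ext i
  have := congrFun h ⟨2 * i + p, by omega⟩
  have h1 : (2 * (i : ℕ) + p) / 2 = i := by omega
  have h2 : (2 * (i : ℕ) + p) % 2 = p := by omega
  simpa [spread, doubled, h1, h2] using this

theorem hyperbolicForm_spread {m p : ℕ} (a b : Fin m → ZMod 2) :
    hyperbolicForm (2 * m) (spread p a) (spread p b) = 0 := by
  rw [hyperbolicForm_apply (even_two_mul m)]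
  refine Finset.sum_eq_zero fun i _ => ?_
  by_cases h : (i : ℕ) % 2 = p
  · have : (blockSwap (even_two_mul m) i : ℕ) % 2 ≠ p := by
      rw [val_blockSwap]
      split <;> omega
    simp [spread, this]
  · simp [spread, h]

theorem exists_isKLOrthogonal_hyperbolicForm (m : ℕ) :
    ∃ S : Finset (Fin (2 * m) → ZMod 2), IsKLOrthogonal (hyperbolicForm (2 * m)) 3 2 S ∧
      S.card = 2 ^ (m + 1) - 2 := by
  refine exists_isKLOrthogonal_of_isotropic_pair (c := 1) (hyperbolicForm_comm (even_two_mul m))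
    (isIsotropicSet_image_univ (hyperbolicForm_spread (p := 0)))
    (isIsotropicSet_image_univ (hyperbolicForm_spread (p := 1)))
    (card_image_univ_of_injective (spread_injective (by norm_num)))
    (card_image_univ_of_injective (spread_injective (by norm_num))) ?_ ?_
  · refine Finset.card_le_one_iff_subset_singleton.2 ⟨0, fun x hx => ?_⟩
    obtain ⟨hx, hx'⟩ := Finset.mem_inter.1 hx
    obtain ⟨a, _, rfl⟩ := Finset.mem_image.1 hx
    obtain ⟨b, _, hb⟩ := Finset.mem_image.1 hx'
    rw [Finset.mem_singleton]
    ext i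
    rcases Nat.mod_two_eq_zero_or_one i with h | h
    · rw [← congrFun hb i]
      simp [spread, h]
    · simp [spread, h]
  · have : 2 ≤ 2 ^ (m + 1) := Nat.le_self_pow (by omega) 2
    omega

theorem exists_isKLOrthogonal_dotForm_even (m : ℕ) :
    ∃ S : Finset (Fin (2 * m) → ZMod 2), IsKLOrthogonal (dotForm (2 * m)) 3 2 S ∧
      S.card = 2 ^ (m + 1) - 3 := by
  rcases m.eq_zero_or_pos with rfl | hm
  -- Truncated subtraction: 2 - 3 = 0.
  · exact ⟨∅, by simp [IsKLOrthogonal, Finset.subset_empty], rfl⟩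
  obtain ⟨N, hN⟩ : ∃ N, 2 * m = N + 1 := ⟨2 * m - 1, by omega⟩
  -- The cyclic shift by one: its pairs straddle adjacent blocks, so the two isotropic spaces share
  -- only the constant vectors.
  let ρ : Equiv.Perm (Fin (2 * m)) := (finCongr hN).trans ((finRotate _).trans (finCongr hN.symm))
  have hρ : ∀ (i : ℕ) (hi : i + 1 < 2 * m), ρ ⟨i, by omega⟩ = ⟨i + 1, hi⟩ := by
    intro i hi
    have : finRotate (N + 1) ⟨i, by omega⟩ = ⟨i + 1, by omega⟩ := finRotate_of_lt (by omega)
    simp [ρ, finCongr_apply, this]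
  have hinj : Function.Injective fun (a : Fin m → ZMod 2) => doubled a ∘ ρ := fun a b h =>
    doubled_injective (ρ.surjective.injective_comp_right h)
  refine exists_isKLOrthogonal_of_isotropic_pair (c := 2) (dotForm_comm _)
    (isIsotropicSet_image_univ (f := doubled) fun a b => by
      rw [dotForm_apply, sum_doubled_mul_doubled])
    (isIsotropicSet_image_univ (f := fun a => doubled a ∘ ρ) fun a b => by
      rw [dotForm_apply]
      exact (Equiv.sum_comp ρ fun i => doubled a i * doubled b i).trans
        (sum_doubled_mul_doubled a b))
    (card_image_univ_of_injective doubled_injective)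
    (card_image_univ_of_injective hinj) ?_ ?_
  · refine (Finset.card_le_card (t := {0, 1}) fun x hx => ?_).trans Finset.card_le_two
    obtain ⟨hx, hx'⟩ := Finset.mem_inter.1 hx
    obtain ⟨a, _, rfl⟩ := Finset.mem_image.1 hx
    obtain ⟨b, _, hb⟩ := Finset.mem_image.1 hx'
    have hconst : ∀ (i : ℕ) (hi : i < 2 * m), doubled a ⟨i, hi⟩ = doubled a ⟨0, by omega⟩ := by
      intro i
      induction i with
      | zero => intro _; rfl
      | succ i ih =>
        intro hi
        rw [← ih (by omega)]
        rcases Nat.mod_two_eq_zero_or_one i with h | h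
        · simp only [doubled]
          congr 2
          omega
        · rw [← congrFun hb ⟨i + 1, hi⟩, ← congrFun hb ⟨i, by omega⟩]
          simp only [Function.comp_apply]
          rw [hρ i hi, hρ (i + 1) (by omega)]
          simp only [doubled]
          congr 2
          omega
    rw [Finset.mem_insert, Finset.mem_singleton]
    refine (zmod_two_cases (doubled a ⟨0, by omega⟩)).imp (fun h => ?_) fun h => ?_ <;>
    · ext i
      rw [hconst i i.isLt, h]
      rfl
  · have : 2 ^ 2 ≤ 2 ^ (m + 1) := Nat.pow_le_pow_right (by norm_num) (by omega)
    omega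

theorem exists_isKLOrthogonal_dotForm_odd {m : ℕ} (hm : 0 < m) :
    ∃ S : Finset (Fin (2 * m + 1) → ZMod 2), IsKLOrthogonal (dotForm (2 * m + 1)) 3 2 S ∧
      S.card = 2 ^ (m + 1) + 1 := by
  -- Two pairings of adjacent coordinates, one leaving out the last coordinate and the other the
  -- first. A common vector is constant along the path they form and starts with 0.
  let f : (Fin m → ZMod 2) → (Fin (2 * m + 1) → ZMod 2) := fun a => Fin.snoc (doubled a) 0
  let g : (Fin m → ZMod 2) → (Fin (2 * m + 1) → ZMod 2) := fun a => Fin.cons 0 (doubled a)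
  have hf : ∀ a b, dotForm (2 * m + 1) (f a) (f b) = 0 := fun a b => by
    simp [dotForm_apply, Fin.sum_univ_castSucc, f, sum_doubled_mul_doubled]
  have hg : ∀ a b, dotForm (2 * m + 1) (g a) (g b) = 0 := fun a b => by
    simp [dotForm_apply, Fin.sum_univ_succ, g, sum_doubled_mul_doubled]
  have hfi : Function.Injective f := fun a b h => by
    refine doubled_injective (funext fun i => ?_)
    simpa [f] using congrFun h i.castSucc
  have hgi : Function.Injective g := fun a b h => by
    refine doubled_injective (funext fun i => ?_)
    simpa [g] using congrFun h i.succ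
  have hfv : ∀ a (i : ℕ) (hi : i < 2 * m), f a ⟨i, by omega⟩ = doubled a ⟨i, hi⟩ :=
    fun a i hi => Fin.snoc_castSucc (α := fun _ => ZMod 2) (0 : ZMod 2) (doubled a) ⟨i, hi⟩
  have hgv : ∀ a (i : ℕ) (hi : i < 2 * m), g a ⟨i + 1, by omega⟩ = doubled a ⟨i, hi⟩ :=
    fun a i hi => rfl
  -- This gives u = (1,1,0,…) and v = (0,1,1,0,…), which overlap in a single coordinate.
  let a₀ : Fin m → ZMod 2 := Pi.single ⟨0, hm⟩ 1
  refine exists_isKLOrthogonal_of_isotropic_pair_of_odd (dotForm_comm _)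
    (isIsotropicSet_image_univ hf) (isIsotropicSet_image_univ hg)
    (card_image_univ_of_injective hfi) (card_image_univ_of_injective hgi) ?_
    (e := 1) (u := f a₀) (v := g a₀) ?_ ?_ ?_
    (Finset.mem_image_of_mem _ (Finset.mem_univ _)) (Finset.mem_image_of_mem _ (Finset.mem_univ _))
    ?_
  · refine Finset.card_le_one_iff_subset_singleton.2 ⟨0, fun x hx => ?_⟩
    obtain ⟨hx, hx'⟩ := Finset.mem_inter.1 hx
    obtain ⟨a, _, rfl⟩ := Finset.mem_image.1 hx
    obtain ⟨b, _, hb⟩ := Finset.mem_image.1 hx'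
    have hzero : ∀ (i : ℕ) (hi : i < 2 * m + 1), f a ⟨i, hi⟩ = 0 := by
      intro i
      induction i with
      | zero =>
        intro hi
        rw [← congrFun hb]
        rfl
      | succ i ih =>
        intro hi
        rw [← ih (by omega)]
        rcases Nat.mod_two_eq_zero_or_one i with h | h
        · rw [hfv a (i + 1) (by omega), hfv a i (by omega)]
          simp only [doubled]
          congr 2
          omega
        · rw [← congrFun hb ⟨i + 1, hi⟩, ← congrFun hb ⟨i, by omega⟩]
          obtain ⟨j, rfl⟩ : ∃ j, i = j + 1 := ⟨i - 1, by omega⟩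
          rw [hgv b (j + 1) (by omega), hgv b j (by omega)]
          simp only [doubled]
          congr 2
          omega
    rw [Finset.mem_singleton]
    exact funext fun i => hzero i i.isLt
  · rw [dotForm_one_one]
    simp [show (2 : ZMod 2) = 0 from rfl]
  · intro x hx
    rw [← dotForm_self]
    exact isIsotropicSet_image_univ hf x hx x hx
  · intro x hx
    rw [← dotForm_self]
    exact isIsotropicSet_image_univ hg x hx x hx
  · have h1 : ∀ i : Fin (2 * m), doubled a₀ i = if (i : ℕ) < 2 then 1 else 0 := by
      intro i
      simp only [doubled, a₀, Pi.single_apply, Fin.mk.injEq]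
      congr 1
      simp only [eq_iff_iff]
      omega
    rw [dotForm_apply, Finset.sum_eq_single (⟨1, by omega⟩ : Fin (2 * m + 1))]
    · rw [hfv a₀ 1 (by omega), hgv a₀ 0 (by omega), h1, h1]
      simp
    · rintro ⟨i, hi⟩ _ hne
      rcases Nat.eq_zero_or_pos i with rfl | hpos
      · exact mul_zero _
      · rcases Nat.lt_or_ge i (2 * m) with h | h
        · have h2 : i ≠ 1 := fun h => hne (Fin.ext h)
          rw [hfv a₀ i h, h1, if_neg (show ¬ i < 2 by omega), zero_mul]
        · obtain rfl : i = 2 * m := by omega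
          have : f a₀ ⟨2 * m, hi⟩ = 0 :=
            Fin.snoc_last (α := fun _ => ZMod 2) (0 : ZMod 2) (doubled a₀)
          rw [this, zero_mul]
    · simp

/-! ### Upper bounds for the two concrete forms -/

theorem IsKLOrthogonal.card_le_of_dotForm_odd {m : ℕ} (hm : 10 ≤ m)
    {S : Finset (Fin (2 * m + 1) → ZMod 2)} (hS : IsKLOrthogonal (dotForm (2 * m + 1)) 3 2 S) :
    S.card ≤ 2 ^ (m + 1) + 1 := by
  obtain ⟨h0, h⟩ := (isKLOrthogonal_three_two_iff (dotForm_comm _)).1 hS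
  exact h.card_le_of_odd hm (dotForm_comm _) (dotForm_nondegenerate _) (dotForm_self _)
    (by rw [dotForm_one_one]; simp [show (2 : ZMod 2) = 0 from rfl]) (by simp) h0

theorem IsKLOrthogonal.card_le_of_dotForm_even {m : ℕ} (hm : 9 ≤ m)
    {S : Finset (Fin (2 * m) → ZMod 2)} (hS : IsKLOrthogonal (dotForm (2 * m)) 3 2 S) :
    S.card ≤ 2 ^ (m + 1) - 3 := by
  obtain ⟨h0, h⟩ := (isKLOrthogonal_three_two_iff (dotForm_comm _)).1 hS
  obtain ⟨k, rfl⟩ : ∃ k, m = k + 1 := ⟨m - 1, by omega⟩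
  have := h.card_le_of_even (k := k) (by omega) (dotForm_comm _) (dotForm_nondegenerate _)
    (dotForm_self _) (fun h => one_ne_zero (congrFun h ⟨0, by omega⟩))
    (by rw [dotForm_one_one]; simp [show (2 : ZMod 2) = 0 from rfl])
    (by rw [Module.finrank_fin_fun]; ring) h0
  exact Nat.le_sub_of_add_le this

theorem IsKLOrthogonal.card_le_of_hyperbolicForm {m : ℕ}
    {S : Finset (Fin (2 * m) → ZMod 2)} (hS : IsKLOrthogonal (hyperbolicForm (2 * m)) 3 2 S) :
    S.card ≤ 2 ^ (m + 1) - 2 := by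
  have hB := hyperbolicForm_comm (even_two_mul m)
  obtain ⟨h0, h⟩ := (isKLOrthogonal_three_two_iff hB).1 hS
  exact Nat.le_sub_of_add_le ((isSymplecticOn_hyperbolicForm m).card_triangleFree_le hB
    (fun _ _ => trivial) h0 (h.isTriangleFree fun x _ => hyperbolicForm_self (even_two_mul m) x))

/-! ### Set families as characteristic vectors, and the final statement -/

/-- The bijection sending a set to its characteristic vector. -/
def charVecEquiv (n : ℕ) : Finset (Fin n) ≃ (Fin n → ZMod 2) where
  toFun X i := if i ∈ X then 1 else 0
  invFun x := Finset.univ.filter fun i => x i = 1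
  left_inv X := by ext i; simp
  right_inv x := by
    ext i
    rcases zmod_two_cases (x i) with h | h <;> simp [h]

theorem dotForm_charVecEquiv_eq_zero_iff {n : ℕ} (X Y : Finset (Fin n)) :
    dotForm n (charVecEquiv n X) (charVecEquiv n Y) = 0 ↔ Even (X ∩ Y).card := by
  rw [← ZMod.natCast_eq_zero_iff_even, dotForm_apply]
  have : ∑ i, charVecEquiv n X i * charVecEquiv n Y i = ((X ∩ Y).card : ZMod 2) := by
    simp [charVecEquiv, Finset.inter_comm]
  rw [this]

theorem charVecEquiv_eq_zero_iff {n : ℕ} (X : Finset (Fin n)) :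
    charVecEquiv n X = 0 ↔ X = ∅ := by
  have : charVecEquiv n ∅ = 0 := by ext i; simp [charVecEquiv]
  rw [← this, (charVecEquiv n).apply_eq_iff_eq]

theorem isAlmostEvenFamily_iff {n : ℕ} (A : Finset (Finset (Fin n))) :
    IsAlmostEvenFamily A ↔
      IsKLOrthogonal (dotForm n) 3 2 (A.map (charVecEquiv n).toEmbedding) := by
  rw [isKLOrthogonal_three_two_iff (dotForm_comm n)]
  refine and_congr ?_ ?_
  · simp only [Finset.mem_map, Equiv.coe_toEmbedding, charVecEquiv_eq_zero_iff, not_exists,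
      not_and, Finset.nonempty_iff_ne_empty, ne_eq]
  · simp only [IsDistinctTriangleFree, Finset.forall_mem_map, Equiv.coe_toEmbedding, ne_eq,
      (charVecEquiv n).apply_eq_iff_eq, dotForm_charVecEquiv_eq_zero_iff]

theorem isAlmostEvenFamily_max_of_dotForm {n N : ℕ}
    (h : (∀ S : Finset (Fin n → ZMod 2), IsKLOrthogonal (dotForm n) 3 2 S → S.card ≤ N) ∧
      ∃ S : Finset (Fin n → ZMod 2), IsKLOrthogonal (dotForm n) 3 2 S ∧ S.card = N) :
    (∀ A : Finset (Finset (Fin n)), IsAlmostEvenFamily A → A.card ≤ N) ∧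
      ∃ A : Finset (Finset (Fin n)), IsAlmostEvenFamily A ∧ A.card = N := by
  refine ⟨fun A hA => ?_, ?_⟩
  · simpa using h.1 _ ((isAlmostEvenFamily_iff A).1 hA)
  · obtain ⟨S, hS, hcard⟩ := h.2
    refine ⟨S.map (charVecEquiv n).symm.toEmbedding, ?_, by simpa using hcard⟩
    rw [isAlmostEvenFamily_iff, Finset.map_map]
    simpa using hS

theorem theorem2p2 (n : ℕ) :
    -- dot product, odd dimension: the bound, and its sharpness
    (Odd n → 21 ≤ n →
      (∀ S : Finset (Fin n → ZMod 2), IsKLOrthogonal (dotForm n) 3 2 S →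
        S.card ≤ 2 ^ ((n + 1) / 2) + 1) ∧
      (∃ S : Finset (Fin n → ZMod 2), IsKLOrthogonal (dotForm n) 3 2 S ∧
        S.card = 2 ^ ((n + 1) / 2) + 1)) ∧
    -- dot product, even dimension
    (Even n → 18 ≤ n →
      (∀ S : Finset (Fin n → ZMod 2), IsKLOrthogonal (dotForm n) 3 2 S →
        S.card ≤ 2 ^ (n / 2 + 1) - 3) ∧
      (∃ S : Finset (Fin n → ZMod 2), IsKLOrthogonal (dotForm n) 3 2 S ∧
        S.card = 2 ^ (n / 2 + 1) - 3)) ∧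
    -- hyperbolic form, even dimension
    (Even n → 2 ≤ n →
      (∀ S : Finset (Fin n → ZMod 2), IsKLOrthogonal (hyperbolicForm n) 3 2 S →
        S.card ≤ 2 ^ (n / 2 + 1) - 2) ∧
      (∃ S : Finset (Fin n → ZMod 2), IsKLOrthogonal (hyperbolicForm n) 3 2 S ∧
        S.card = 2 ^ (n / 2 + 1) - 2)) ∧
    -- almost even-intersection families, odd ground set
    (Odd n → 21 ≤ n →
      (∀ A : Finset (Finset (Fin n)), IsAlmostEvenFamily A →
        A.card ≤ 2 ^ ((n + 1) / 2) + 1) ∧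
      (∃ A : Finset (Finset (Fin n)), IsAlmostEvenFamily A ∧
        A.card = 2 ^ ((n + 1) / 2) + 1)) ∧
    -- almost even-intersection families, even ground set
    (Even n → 18 ≤ n →
      (∀ A : Finset (Finset (Fin n)), IsAlmostEvenFamily A →
        A.card ≤ 2 ^ (n / 2 + 1) - 3) ∧
      (∃ A : Finset (Finset (Fin n)), IsAlmostEvenFamily A ∧
        A.card = 2 ^ (n / 2 + 1) - 3)) := by
  have hodd : Odd n → 21 ≤ n →
      (∀ S : Finset (Fin n → ZMod 2), IsKLOrthogonal (dotForm n) 3 2 S →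
        S.card ≤ 2 ^ ((n + 1) / 2) + 1) ∧
      (∃ S : Finset (Fin n → ZMod 2), IsKLOrthogonal (dotForm n) 3 2 S ∧
        S.card = 2 ^ ((n + 1) / 2) + 1) := by
    rintro ⟨m, rfl⟩ hn
    rw [show (2 * m + 1 + 1) / 2 = m + 1 by omega]
    exact ⟨fun S hS => hS.card_le_of_dotForm_odd (by omega),
      exists_isKLOrthogonal_dotForm_odd (by omega)⟩
  have heven : Even n → 18 ≤ n →
      (∀ S : Finset (Fin n → ZMod 2), IsKLOrthogonal (dotForm n) 3 2 S →
        S.card ≤ 2 ^ (n / 2 + 1) - 3) ∧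
      (∃ S : Finset (Fin n → ZMod 2), IsKLOrthogonal (dotForm n) 3 2 S ∧
        S.card = 2 ^ (n / 2 + 1) - 3) := by
    intro hn h18
    obtain ⟨m, rfl⟩ := hn.exists_two_nsmul
    rw [smul_eq_mul] at *
    rw [show 2 * m / 2 = m by omega]
    exact ⟨fun S hS => hS.card_le_of_dotForm_even (by omega), exists_isKLOrthogonal_dotForm_even m⟩
  refine ⟨hodd, heven, ?_, fun h1 h2 => isAlmostEvenFamily_max_of_dotForm (hodd h1 h2),
    fun h1 h2 => isAlmostEvenFamily_max_of_dotForm (heven h1 h2)⟩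
  intro hn _
  obtain ⟨m, rfl⟩ := hn.exists_two_nsmul
  rw [smul_eq_mul]
  rw [show 2 * m / 2 = m by omega]
  exact ⟨fun S hS => hS.card_le_of_hyperbolicForm, exists_isKLOrthogonal_hyperbolicForm m⟩
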